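/- **Setting.** Let $d\ge 1$, $T>0$, $a>0$, $\gamma>1$, $p(\varrho)=a\varrho^\gamma$. Let $\mathbb T^d=(\mathbb R/\mathbb Z)^d$ be the flat torus, identified with the cell $\Omega=(0,1)^d\subset\mathbb R^d$ (so $\partial\Omega$ is the boundary of the cell), and let $Q=(0,T)\times\mathbb T^d$. For $\varrho\in\mathbb R$, $\mathbf m\in\mathbb R^d$ let $E(\varrho,\mathbf m)=\frac12\frac{|\mathbf m|^2}{\varrho}+\frac{a}{\gamma-1}\varrho^\gamma$ if $\varrho>0$, $E(0,0)=0$, and $E=\infty$ otherwise. Let $\varrho_0,\varrho_{0,n}\in L^1(\mathbb T^d)$ and $\mathbf m_0,\mathbf m_{0,n}\in L^1(\mathbb T^d;\mathbb R^d)$, $n=1,2,\dots$, with $\int_{\mathbb T^d}E(\varrho_0,\mathbf m_0)\,dx<\infty$, and let $E_n\in[0,\infty)$. **Consistent approximation (zero Reynolds stress).** Measurable functions $(\varrho_n,\mathbf m_n):Q\to\mathbb R\times\mathbb R^d$ form a consistent approximation, with zero approximate Reynolds stress, of the isentropic Euler system with data $(\varrho_0,\mathbf m_0)$ if, for all $\varphi\in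 C_c^\infty([0,T)\times\mathbb T^d)$ and $\boldsymbol\varphi\in C_c^\infty([0,T)\times\mathbb T^d;\mathbb R^d)$, $$\int_0^T\!\!\int_{\mathbb T^d}\big[\varrho_n\partial_t\varphi+\mathbf m_n\cdot\nabla_x\varphi\big]\,dx\,dt=-\int_{\mathbb T^d}\varrho_{0,n}\varphi(0,\cdot)\,dx+e_n^1[\varphi],$$ $$\int_0^T\!\!\int_{\mathbb T^d}\Big[\mathbf m_n\cdot\partial_t\boldsymbol\varphi+1_{\varrho_n>0}\frac{\mathbf m_n\otimes\mathbf m_n}{\varrho_n}:\nabla_x\boldsymbol\varphi+p(\varrho_n)\,\mathrm{div}_x\boldsymbol\varphi\Big]\,dx\,dt=-\int_{\mathbb T^d}\mathbf m_{0,n}\cdot\boldsymbol\varphi(0,\cdot)\,dx+e_n^2[\boldsymbol\varphi],$$ where $e_n^1[\varphi]\to0$ and $e_n^2[\boldsymbol\varphi]\to0$ as $n\to\infty$; $\int_{\mathbb T^d}E(\varrho_n,\mathbf m_n)(t,\cdot)\,dx\le E_n$ for all $n$ and a.a. $t\in(0,T)$; $\varrho_{0,n}\to\varrho_0$ and $\mathbf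 m_{0,n}\to\mathbf m_0$ weakly in $L^1(\mathbb T^d)$; and $\limsup_{n\to\infty}E_n\le\int_{\mathbb T^d}E(\varrho_0,\mathbf m_0)\,dx$. **(S)-convergence.** Write $\mathbf U_n=(\varrho_n,\mathbf m_n):Q\to\mathbb R^{d+1}$. The sequence is weakly (S)-convergent if for each $b\in C_c(\mathbb R^{d+1})$ the limit $c_m=\lim_{N\to\infty}\frac1N\sum_{n=1}^N\int_Q b(\mathbf U_n)b(\mathbf U_m)\,dy$ exists for every fixed $m$, and the limits $\lim_{N\to\infty}\frac1{N^2}\sum_{n,m=1}^N\int_Q b(\mathbf U_n)b(\mathbf U_m)\,dy$ and $\lim_{M\to\infty}\frac1M\sum_{m=1}^M c_m$ exist and are equal. For $\mathcal V\in L^\infty_{\text{weak-}(*)}(Q;\mathcal M^+(\mathbb R^{d+1}))$ we write $\mathbf U_n\stackrel{(S)}{\to}\mathcal V$ if the sequence is weakly (S)-convergent and $\frac1N\sum_{n=1}^N b(\mathbf U_n)\to\langle\mathcal V;b\rangle$ weakly-(*) in $L^\infty(Q)$ for each $b\in C_c(\mathbb R^{d+1})$. **Weak solution.** $(\varrho,\mathbf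 m)$ is a weak solution of the isentropic Euler system if $\varrho\ge0$ a.e., the functions $\varrho$, $\mathbf m$, $1_{\varrho>0}\frac{\mathbf m\otimes\mathbf m}{\varrho}$, $p(\varrho)$ are locally integrable in $(0,T)\times\mathbb T^d$, and $$\partial_t\varrho+\mathrm{div}_x\mathbf m=0,\qquad \partial_t\mathbf m+\mathrm{div}_x\Big(1_{\varrho>0}\frac{\mathbf m\otimes\mathbf m}{\varrho}\Big)+\nabla_xp(\varrho)=0\qquad\text{in }\mathcal D'((0,T)\times\mathbb T^d).$$ **Theorem.** Let $\{\varrho_n,\mathbf m_n\}_{n=1}^\infty$ be a consistent approximation of the isentropic Euler system with zero approximate Reynolds stress, and suppose $(\varrho_n,\mathbf m_n)\stackrel{(S)}{\to}\mathcal V$. Let $\varrho=\langle\mathcal V;\tilde\varrho\rangle$, $\mathbf m=\langle\mathcal V;\tilde{\mathbf m}\rangle$ be the barycenter of $\mathcal V$. Suppose that for some open neighborhood $\mathcal U$ of $\partial\Omega$ $$\frac1N\sum_{n=1}^N\int_0^T\!\!\int_{\mathcal U\cap\Omega}E(\varrho_n,\mathbf m_n)\,dx\,dt\to\int_0^T\!\!\int_{\mathcal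 U\cap\Omega}E(\varrho,\mathbf m)\,dx\,dt\quad\text{as }N\to\infty,$$ and that $(\varrho,\mathbf m)$ is a weak solution of the isentropic Euler system. Then $$\mathcal V_{(t,x)}=\delta_{(\varrho,\mathbf m)(t,x)}\quad\text{for a.a. }(t,x)\in(0,T)\times\mathbb T^d.$$ -/

import Mathlib

open scoped ContDiff

/-! The isentropic Euler system on `(0,T) × 𝕋^d`, consistent approximations and (S)-convergence.
The flat torus `𝕋^d = (ℝ/ℤ)^d` is identified with the bounded subset `(0,1)^d` of `ℝ^d`
(up to a null set): states are functions on the cell, test functions are periodic on `ℝ^d`.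
Sequences are indexed by `ℕ`, the index `n` here being the index `n + 1` of a sequence that
starts at one. -/

namespace IsentropicEuler

noncomputable section

open MeasureTheory Filter Topology
open scoped ENNReal NNReal

/-! ### (S)-convergence -/

/-- Weak (S)-convergence of measurable functions `U n : Y → X` on a measure space `(Y, μ)`:
for each `b ∈ C_c(X)` the correlation limit
`c m = lim_N N⁻¹ ∑_{n ≤ N} ∫ b(U n) b(U m)` exists for every `m`, and the limits of
`N⁻² ∑_{n, m ≤ N} ∫ b(U n) b(U m)` and of `M⁻¹ ∑_{m ≤ M} c m` exist and are equal. -/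
def WeaklySConvergent {Y X : Type*} [MeasurableSpace Y] [TopologicalSpace X] [MeasurableSpace X]
    (μ : Measure Y) (U : ℕ → Y → X) : Prop :=
  (∀ n, AEMeasurable (U n) μ) ∧
  ∀ b : X → ℝ, Continuous b → HasCompactSupport b →
    ∃ c : ℕ → ℝ,
      (∀ m, Tendsto (fun N : ℕ => (N : ℝ)⁻¹ * ∑ n ∈ Finset.range N,
          ∫ y, b (U n y) * b (U m y) ∂μ) atTop (𝓝 (c m))) ∧
      ∃ L : ℝ,
        Tendsto (fun N : ℕ => ((N : ℝ) ^ 2)⁻¹ * ∑ n ∈ Finset.range N, ∑ m ∈ Finset.range N,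
          ∫ y, b (U n y) * b (U m y) ∂μ) atTop (𝓝 L) ∧
        Tendsto (fun M : ℕ => (M : ℝ)⁻¹ * ∑ m ∈ Finset.range M, c m) atTop (𝓝 L)

/-- `V` represents an element of `L^∞_{weak-*}(Y; 𝓜⁺(X))`. -/
def IsParametrizedMeasure {Y X : Type*} [MeasurableSpace Y] [TopologicalSpace X]
    [MeasurableSpace X] (μ : Measure Y) (V : Y → Measure X) : Prop :=
  (∀ b : X → ℝ, Continuous b → HasCompactSupport b →
    AEStronglyMeasurable (fun y => ∫ z, b z ∂(V y)) μ) ∧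
  ∃ C : ℝ≥0, ∀ᵐ y ∂μ, V y Set.univ ≤ C

/-- `U n → V` in the sense of (S): the sequence is weakly (S)-convergent and `V` is its (S)-limit,
that is `⟨V ; b⟩` is the weak-(*) limit in `L^∞(Y)` of the means `N⁻¹ ∑_{n ≤ N} b(U n)`,
for each `b ∈ C_c(X)`. -/
structure SConvergesTo {Y X : Type*} [MeasurableSpace Y] [TopologicalSpace X] [MeasurableSpace X]
    (μ : Measure Y) (U : ℕ → Y → X) (V : Y → Measure X) : Prop where
  weaklySConvergent : WeaklySConvergent μ U
  isParametrizedMeasure : IsParametrizedMeasure μ V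
  tendsto : ∀ b : X → ℝ, Continuous b → HasCompactSupport b → ∀ g : Y → ℝ, Integrable g μ →
    Tendsto (fun N : ℕ => ∫ y, g y * ((N : ℝ)⁻¹ * ∑ n ∈ Finset.range N, b (U n y)) ∂μ) atTop
      (𝓝 (∫ y, g y * ∫ z, b z ∂(V y) ∂μ))

/-! ### Domain and test functions -/

/-- `ℝ^d` with its Euclidean norm. -/
abbrev Vec (d : ℕ) := EuclideanSpace ℝ (Fin d)

/-- The periodicity cell `Ω = (0,1)^d` of the torus. -/
def cell (d : ℕ) : Set (Vec d) := {x | ∀ i, x i ∈ Set.Ioo (0 : ℝ) 1}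

/-- Lebesgue measure on the space-time domain `(0,T) × Ω`. -/
def spaceTime (d : ℕ) (T : ℝ) : Measure (ℝ × Vec d) :=
  (volume : Measure (ℝ × Vec d)).restrict (Set.Ioo 0 T ×ˢ cell d)

/-- Test functions of class `C_c^∞([0,T) × 𝕋^d; F)`, represented by smooth functions on
`ℝ × ℝ^d` that are `ℤ^d`-periodic in space and vanish for times near `T` and beyond. -/
structure IsTestFunction {d : ℕ} {F : Type*} [NormedAddCommGroup F] [NormedSpace ℝ F]
    (T : ℝ) (φ : ℝ × Vec d → F) : Prop where
  smooth : ContDiff ℝ ∞ φ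
  periodic : ∀ t x i, φ (t, x + EuclideanSpace.single i 1) = φ (t, x)
  vanish : ∃ T' < T, ∀ t x, T' ≤ t → φ (t, x) = 0

/-- Test functions of class `C_c^∞((0,T) × 𝕋^d; F)`. -/
structure IsInteriorTestFunction {d : ℕ} {F : Type*} [NormedAddCommGroup F] [NormedSpace ℝ F]
    (T : ℝ) (φ : ℝ × Vec d → F) : Prop extends IsTestFunction T φ where
  vanish_left : ∃ δ > 0, ∀ t x, t ≤ δ → φ (t, x) = 0

/-- Time derivative. -/
def dt {d : ℕ} {F : Type*} [NormedAddCommGroup F] [NormedSpace ℝ F]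
    (φ : ℝ × Vec d → F) (y : ℝ × Vec d) : F :=
  fderiv ℝ φ y (1, 0)

/-- Partial derivative in the `j`-th space variable. -/
def dx {d : ℕ} {F : Type*} [NormedAddCommGroup F] [NormedSpace ℝ F]
    (j : Fin d) (φ : ℝ × Vec d → F) (y : ℝ × Vec d) : F :=
  fderiv ℝ φ y (0, EuclideanSpace.single j 1)

/-! ### The isentropic Euler system -/

/-- The pressure `p(ϱ) = a ϱ^γ`. -/
def pressure (a γ ϱ : ℝ) : ℝ := a * ϱ ^ γ

open Classical in
/-- The energy `E(ϱ, m) ∈ [0, ∞]`: it is `|m|² / (2 ϱ) + P(ϱ)`, `P(ϱ) = a ϱ^γ / (γ - 1)`, if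
`ϱ > 0`, zero if `ϱ = 0` and `m = 0`, and infinite otherwise. -/
def energy {d : ℕ} (a γ ϱ : ℝ) (m : Vec d) : ℝ≥0∞ :=
  if 0 < ϱ then ENNReal.ofReal (1 / 2 * (‖m‖ ^ 2 / ϱ) + a / (γ - 1) * ϱ ^ γ)
  else if ϱ = 0 ∧ m = 0 then 0 else ⊤

/-- The convective flux `1_{ϱ > 0} (m ⊗ m) / ϱ`, entry `(i, j)`. -/
def convFlux {d : ℕ} (ϱ : ℝ) (m : Vec d) (i j : Fin d) : ℝ :=
  if 0 < ϱ then m i * m j / ϱ else 0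

/-- `∫_0^T ∫_Ω [ϱ ∂_t φ + m · ∇φ] dx dt`. -/
def continuityForm {d : ℕ} (T : ℝ) (ϱ : ℝ × Vec d → ℝ) (m : ℝ × Vec d → Vec d)
    (φ : ℝ × Vec d → ℝ) : ℝ :=
  ∫ y, (ϱ y * dt φ y + ∑ j, m y j * dx j φ y) ∂(spaceTime d T)

/-- `∫_0^T ∫_Ω [m · ∂_t φ + 1_{ϱ > 0} (m ⊗ m) / ϱ : ∇φ + p(ϱ) div φ] dx dt`. -/
def momentumForm {d : ℕ} (T a γ : ℝ) (ϱ : ℝ × Vec d → ℝ) (m : ℝ × Vec d → Vec d)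
    (φ : ℝ × Vec d → Vec d) : ℝ :=
  ∫ y, ((∑ i, m y i * dt φ y i) + (∑ i, ∑ j, convFlux (ϱ y) (m y) i j * dx j φ y i)
    + pressure a γ (ϱ y) * ∑ i, dx i φ y i) ∂(spaceTime d T)

/-- `(ϱ, m)` is a weak (distributional) solution of the isentropic Euler system in
`(0,T) × 𝕋^d`. -/
structure IsWeakSolution {d : ℕ} (T a γ : ℝ) (ϱ : ℝ × Vec d → ℝ) (m : ℝ × Vec d → Vec d) :
    Prop where
  nonneg : ∀ᵐ y ∂(spaceTime d T), 0 ≤ ϱ y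
  integrable_density : ∀ δ T', 0 < δ → T' < T →
    IntegrableOn ϱ (Set.Ioo δ T' ×ˢ cell d) volume
  integrable_momentum : ∀ δ T', 0 < δ → T' < T →
    IntegrableOn m (Set.Ioo δ T' ×ˢ cell d) volume
  integrable_convFlux : ∀ δ T', 0 < δ → T' < T → ∀ i j,
    IntegrableOn (fun y => convFlux (ϱ y) (m y) i j) (Set.Ioo δ T' ×ˢ cell d) volume
  integrable_pressure : ∀ δ T', 0 < δ → T' < T →
    IntegrableOn (fun y => pressure a γ (ϱ y)) (Set.Ioo δ T' ×ˢ cell d) volume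
  continuity : ∀ φ : ℝ × Vec d → ℝ, IsInteriorTestFunction T φ → continuityForm T ϱ m φ = 0
  momentum : ∀ φ : ℝ × Vec d → Vec d, IsInteriorTestFunction T φ → momentumForm T a γ ϱ m φ = 0

/-- `(ϱ n, m n)` is a consistent approximation, with zero approximate Reynolds stress, of the
isentropic Euler system with initial data `(ϱ₀, m₀)` of finite energy; `(ϱ₀n n, m₀n n)` are the
approximate initial data and `E n` the energy bounds. -/
structure IsConsistentApproximation {d : ℕ} (T a γ : ℝ)
    (ϱ : ℕ → ℝ × Vec d → ℝ) (m : ℕ → ℝ × Vec d → Vec d)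
    (ϱ₀n : ℕ → Vec d → ℝ) (m₀n : ℕ → Vec d → Vec d) (E : ℕ → ℝ≥0)
    (ϱ₀ : Vec d → ℝ) (m₀ : Vec d → Vec d) : Prop where
  measurable_density : ∀ n, AEMeasurable (ϱ n) (spaceTime d T)
  measurable_momentum : ∀ n, AEMeasurable (m n) (spaceTime d T)
  integrable_density₀n : ∀ n, IntegrableOn (ϱ₀n n) (cell d) volume
  integrable_momentum₀n : ∀ n, IntegrableOn (m₀n n) (cell d) volume
  integrable_density₀ : IntegrableOn ϱ₀ (cell d) volume
  integrable_momentum₀ : IntegrableOn m₀ (cell d) volume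
  /-- Approximate equation of continuity: the errors `e¹_n[φ]` vanish in the limit. -/
  continuity : ∀ φ : ℝ × Vec d → ℝ, IsTestFunction T φ →
    Tendsto (fun n => continuityForm T (ϱ n) (m n) φ + ∫ x in cell d, ϱ₀n n x * φ (0, x))
      atTop (𝓝 0)
  /-- Approximate momentum equation: the errors `e²_n[φ]` vanish in the limit. -/
  momentum : ∀ φ : ℝ × Vec d → Vec d, IsTestFunction T φ →
    Tendsto (fun n => momentumForm T a γ (ϱ n) (m n) φ
      + ∫ x in cell d, ∑ i, m₀n n x i * φ (0, x) i) atTop (𝓝 0)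
  /-- Approximate energy balance. -/
  energy_le : ∀ n, ∀ᵐ t ∂(volume.restrict (Set.Ioo 0 T)),
    ∫⁻ x in cell d, energy a γ (ϱ n (t, x)) (m n (t, x)) ≤ E n
  /-- `ϱ₀n → ϱ₀` weakly in `L¹`. -/
  density₀ : ∀ g : Vec d → ℝ, MemLp g ⊤ (volume.restrict (cell d)) →
    Tendsto (fun n => ∫ x in cell d, ϱ₀n n x * g x) atTop (𝓝 (∫ x in cell d, ϱ₀ x * g x))
  /-- `m₀n → m₀` weakly in `L¹`. -/
  momentum₀ : ∀ g : Vec d → Vec d, MemLp g ⊤ (volume.restrict (cell d)) →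
    Tendsto (fun n => ∫ x in cell d, ∑ i, m₀n n x i * g x i) atTop
      (𝓝 (∫ x in cell d, ∑ i, m₀ x i * g x i))
  finite_energy₀ : ∫⁻ x in cell d, energy a γ (ϱ₀ x) (m₀ x) < ⊤
  limsup_energy : limsup (fun n => (E n : ℝ≥0∞)) atTop
    ≤ ∫⁻ x in cell d, energy a γ (ϱ₀ x) (m₀ x)

/-- The density component `⟨V_y ; ϱ̃⟩` of the barycenter. -/
def meanDensity {d : ℕ} (V : ℝ × Vec d → Measure (ℝ × Vec d)) (y : ℝ × Vec d) : ℝ :=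
  ∫ z, z.1 ∂(V y)

/-- The momentum component `⟨V_y ; m̃⟩` of the barycenter. -/
def meanMomentum {d : ℕ} (V : ℝ × Vec d → Measure (ℝ × Vec d)) (y : ℝ × Vec d) : Vec d :=
  ∫ z, z.2 ∂(V y)

end

end IsentropicEuler

/-! The momentum equation is tested with a field that behaves like `ψ(t) x`. Its gradient is `ψ(t)`
times the identity, so the stress enters only through its trace `|m|² / ϱ + d p(ϱ)`, a convex
function of the state. The remaining term `m · ∂_t φ` is linear in the state, and the Cesàro means
of such terms converge to their value at the barycenter, because the energy grows superlinearly. The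
errors vanish in the limit and the barycenter solves the same equation; hence the means of the
tested stress converge to the tested stress of the barycenter. On the other hand the limit of the
means bounds the integral of `⟨V; stress⟩` from above (lower semicontinuity), and Jensen's
inequality bounds the latter from below by the stress of the barycenter. All inequalities are
therefore equalities almost everywhere, and equality in Jensen's inequality leaves only Dirac
masses: strict convexity of `ϱ^γ` fixes the density, after which the kinetic part fixes the
momentum.

The field `x` is not periodic. It is replaced by `(f(x₁), …, f(x_d))` with `f` smooth, periodic and
equal to the identity away from the integers. The gradient remains diagonal, but near the boundary
of the cell its entries may be negative and convexity is lost. The assumed convergence of the energy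
there repairs this: the energy combines the same quantities `m_i² / ϱ` and `p(ϱ)` with positive
coefficients, so a large multiple of it, added near the boundary, makes every weight positive.

The argument rests on `SConvergesTo.lintegral_iSup_le` (lower semicontinuity),
`SConvergesTo.tendsto_integral_of_isSuperlinear` (linear terms), `eq_dirac_of_stressPart_mean_eq`
(equality in Jensen), `SConvergesTo.ae_eq_dirac` (these combined, for general weights),
`tendsto_mean_integral_diag` (the tested equation) and `ae_eq_dirac_of_mem_Ioo` (the choice of
weights). -/

namespace IsentropicEuler

noncomputable section

open MeasureTheory Filter Topology
open scoped ENNReal NNReal ContDiff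

/-! ### Cutoffs -/

/-- Cutoff equal to one on the ball of radius `j` and vanishing off the ball of radius `j + 1`. -/
def cutoff {X : Type*} [NormedAddCommGroup X] (j : ℕ) (z : X) : ℝ := max 0 (min 1 (j + 1 - ‖z‖))

section cutoff

variable {X : Type*} [NormedAddCommGroup X]

theorem continuous_cutoff (j : ℕ) : Continuous (cutoff j : X → ℝ) := by
  unfold cutoff; fun_prop

theorem cutoff_nonneg (j : ℕ) (z : X) : 0 ≤ cutoff j z := le_max_left _ _

theorem cutoff_le_one (j : ℕ) (z : X) : cutoff j z ≤ 1 := max_le zero_le_one (min_le_left _ _)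

theorem cutoff_mono (z : X) : Monotone fun j : ℕ => cutoff j z := by
  intro j k h
  have : (j : ℝ) ≤ k := by exact_mod_cast h
  exact max_le_max le_rfl (min_le_min le_rfl (by linarith))

theorem cutoff_eq_one {j : ℕ} {z : X} (h : ‖z‖ ≤ j) : cutoff j z = 1 := by
  unfold cutoff
  rw [min_eq_left (by linarith), max_eq_right zero_le_one]

theorem hasCompactSupport_cutoff [ProperSpace X] (j : ℕ) :
    HasCompactSupport (cutoff j : X → ℝ) := by
  refine HasCompactSupport.of_support_subset_isCompact (isCompact_closedBall 0 (j + 1)) ?_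
  intro z hz
  rw [mem_closedBall_zero_iff]
  by_contra! h
  apply hz
  unfold cutoff
  exact max_eq_left ((min_le_right _ _).trans (by linarith))

theorem eventually_cutoff_eq_one (z : X) : ∀ᶠ j : ℕ in atTop, cutoff j z = 1 := by
  obtain ⟨J, hJ⟩ := exists_nat_ge ‖z‖
  filter_upwards [eventually_ge_atTop J] with j hj
  exact cutoff_eq_one (hJ.trans (by exact_mod_cast hj))

end cutoff

/-! ### Components of the stress and of the energy -/

section state

variable {d : ℕ} {a γ : ℝ}

/-- The states of finite energy. -/
def admissible (d : ℕ) : Set (ℝ × Vec d) := {z | 0 < z.1 ∨ z = 0}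

/-- The pressure and the diagonal entries of the convective flux. -/
def stressPart (a γ : ℝ) : Option (Fin d) → ℝ × Vec d → ℝ
  | none, z => pressure a γ z.1
  | some i, z => convFlux z.1 z.2 i i

/-- Continuous approximations from below of `stressPart`. -/
def stressApprox (a γ : ℝ) (j : ℕ) : Option (Fin d) → ℝ × Vec d → ℝ
  | none, z => pressure a γ (max z.1 0)
  | some i, z => z.2 i ^ 2 / (max z.1 0 + 1 / (j + 1))

/-- The coefficients of the parts of the stress in the energy. -/
def energyCoef (γ : ℝ) : Option (Fin d) → ℝ
  | none => 1 / (γ - 1)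
  | some _ => 1 / 2

/-- Continuous approximations from below of the energy. -/
def energyApprox (a γ : ℝ) (j : ℕ) (z : ℝ × Vec d) : ℝ :=
  ∑ k, energyCoef γ k * stressApprox a γ j k z + j * max (-z.1) 0

theorem nonneg_of_mem_admissible {z : ℝ × Vec d} (hz : z ∈ admissible d) : 0 ≤ z.1 := by
  rcases hz with h | h
  · exact h.le
  · simp [h]

theorem energyCoef_pos (hγ : 1 < γ) (k : Option (Fin d)) : 0 < energyCoef γ k := by
  cases k with
  | none => exact div_pos one_pos (sub_pos.2 hγ)
  | some i => exact one_half_pos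

theorem measurable_stressPart (k : Option (Fin d)) : Measurable (stressPart (d := d) a γ k) := by
  cases k with
  | none => unfold stressPart pressure; fun_prop
  | some i =>
    unfold stressPart convFlux
    refine Measurable.ite (measurableSet_lt measurable_const measurable_fst) ?_ measurable_const
    fun_prop

theorem stressPart_nonneg (ha : 0 < a) {z : ℝ × Vec d} (hz : 0 ≤ z.1) (k : Option (Fin d)) :
    0 ≤ stressPart a γ k z := by
  cases k with
  | none => exact mul_nonneg ha.le (Real.rpow_nonneg hz _)
  | some i =>
    simp only [stressPart, convFlux]
    split_ifs with h
    · exact div_nonneg (mul_self_nonneg _) h.le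
    · exact le_rfl

theorem stressPart_zero (hγ : 1 < γ) (k : Option (Fin d)) :
    stressPart a γ k (0 : ℝ × Vec d) = 0 := by
  cases k with
  | none => simp [stressPart, pressure, Real.zero_rpow (by linarith : γ ≠ 0)]
  | some i => simp [stressPart, convFlux]

theorem stressApprox_nonneg (ha : 0 < a) (j : ℕ) (k : Option (Fin d)) (z : ℝ × Vec d) :
    0 ≤ stressApprox a γ j k z := by
  cases k with
  | none => exact mul_nonneg ha.le (Real.rpow_nonneg (le_max_right _ _) _)
  | some i => simp only [stressApprox]; positivity

theorem continuous_stressApprox (hγ : 1 < γ) (j : ℕ) (k : Option (Fin d)) :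
    Continuous (stressApprox (d := d) a γ j k) := by
  cases k with
  | none =>
    unfold stressApprox pressure
    exact continuous_const.mul (Continuous.rpow_const (by fun_prop) fun z => Or.inr (by linarith))
  | some i =>
    unfold stressApprox
    refine Continuous.div (by fun_prop) (by fun_prop) fun z => ?_
    positivity

theorem stressApprox_mono (k : Option (Fin d)) (z : ℝ × Vec d) :
    Monotone fun j => stressApprox a γ j k z := by
  cases k with
  | none => intro j k _; exact le_rfl
  | some i =>
    intro j k h
    have : (j : ℝ) ≤ k := by exact_mod_cast h
    simp only [stressApprox]
    gcongr

/-- Admissibility is essential: at zero density and nonzero momentum the kinetic approximations blow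
up, while `convFlux` is zero by convention. -/
theorem stressApprox_le (hγ : 1 < γ) {z : ℝ × Vec d} (hz : z ∈ admissible d) (j : ℕ)
    (k : Option (Fin d)) : stressApprox a γ j k z ≤ stressPart a γ k z := by
  rcases hz with h | rfl
  · cases k with
    | none => simp [stressApprox, stressPart, max_eq_left h.le]
    | some i =>
      simp only [stressApprox, stressPart, convFlux, if_pos h, max_eq_left h.le, ← pow_two]
      gcongr
      simp only [le_add_iff_nonneg_right]
      positivity
  · rw [stressPart_zero hγ]
    cases k with
    | none => simp [stressApprox, pressure, Real.zero_rpow (by linarith : γ ≠ 0)]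
    | some i => simp [stressApprox]

theorem tendsto_stressApprox (hγ : 1 < γ) {z : ℝ × Vec d} (hz : z ∈ admissible d)
    (k : Option (Fin d)) :
    Tendsto (fun j => stressApprox a γ j k z) atTop (𝓝 (stressPart a γ k z)) := by
  rcases hz with h | rfl
  · cases k with
    | none => simp [stressApprox, stressPart, max_eq_left h.le]
    | some i =>
      simp only [stressApprox, stressPart, convFlux, if_pos h, max_eq_left h.le, ← pow_two]
      refine Tendsto.div tendsto_const_nhds ?_ h.ne'
      simpa using (tendsto_one_div_add_atTop_nhds_zero_nat (𝕜 := ℝ)).const_add z.1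
  · rw [stressPart_zero hγ]
    cases k with
    | none => simp [stressApprox, pressure, Real.zero_rpow (by linarith : γ ≠ 0)]
    | some i => simp [stressApprox]

theorem tendsto_cutoff_mul_stressApprox (hγ : 1 < γ) {z : ℝ × Vec d} (hz : z ∈ admissible d)
    (k : Option (Fin d)) :
    Tendsto (fun j => cutoff j z * stressApprox a γ j k z) atTop (𝓝 (stressPart a γ k z)) := by
  refine (tendsto_stressApprox hγ hz k).congr' ?_
  filter_upwards [eventually_cutoff_eq_one z] with j hj
  rw [hj, one_mul]

theorem ofReal_stressPart_le_iSup (hγ : 1 < γ) {z : ℝ × Vec d} (hz : z ∈ admissible d)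
    (k : Option (Fin d)) :
    ENNReal.ofReal (stressPart a γ k z)
      ≤ ⨆ j, ENNReal.ofReal (cutoff j z * stressApprox a γ j k z) :=
  le_of_tendsto (ENNReal.tendsto_ofReal (tendsto_cutoff_mul_stressApprox hγ hz k))
    (Eventually.of_forall fun j =>
      le_iSup (fun j => ENNReal.ofReal (cutoff j z * stressApprox a γ j k z)) j)

theorem monotone_cutoff_mul_stressApprox (ha : 0 < a) (k : Option (Fin d)) (z : ℝ × Vec d) :
    Monotone fun j => cutoff j z * stressApprox a γ j k z := fun _ _ h =>
  mul_le_mul (cutoff_mono z h) (stressApprox_mono k z h) (stressApprox_nonneg ha _ _ _)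
    (cutoff_nonneg _ _)

/-! ### The energy -/

theorem energy_eq_sum {z : ℝ × Vec d} (hγ : 1 < γ) (hz : z ∈ admissible d) :
    energy a γ z.1 z.2 = ENNReal.ofReal (∑ k, energyCoef γ k * stressPart a γ k z) := by
  rcases hz with h | rfl
  · simp only [energy, if_pos h, Fintype.sum_option, energyCoef, stressPart, pressure, convFlux,
      EuclideanSpace.real_norm_sq_eq, Finset.sum_div, ← Finset.mul_sum, ← pow_two]
    congr 1
    ring
  · simp [energy, stressPart_zero hγ]

theorem energy_eq_top {z : ℝ × Vec d} (hz : z ∉ admissible d) : energy a γ z.1 z.2 = ⊤ := by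
  simp only [admissible, Set.mem_ofPred_eq, not_or] at hz
  rw [energy, if_neg hz.1, if_neg]
  rintro ⟨h1, h2⟩
  exact hz.2 (Prod.ext h1 h2)

theorem mem_admissible_of_energy_lt_top {z : ℝ × Vec d} (h : energy a γ z.1 z.2 < ⊤) :
    z ∈ admissible d := by
  by_contra hz
  exact h.ne (energy_eq_top hz)

theorem measurable_energy :
    Measurable fun z : ℝ × Vec d => energy a γ z.1 z.2 := by
  unfold energy
  refine Measurable.ite (measurableSet_lt measurable_const measurable_fst) (by fun_prop) ?_
  refine Measurable.ite ?_ measurable_const measurable_const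
  exact (measurableSet_eq_fun measurable_fst measurable_const).inter
    (measurableSet_eq_fun measurable_snd measurable_const)

theorem energyApprox_nonneg (ha : 0 < a) (hγ : 1 < γ) (j : ℕ) (z : ℝ × Vec d) :
    0 ≤ energyApprox a γ j z :=
  add_nonneg (Finset.sum_nonneg fun k _ => mul_nonneg (energyCoef_pos hγ k).le
    (stressApprox_nonneg ha j k z)) (mul_nonneg j.cast_nonneg (le_max_right _ _))

theorem continuous_energyApprox (hγ : 1 < γ) (j : ℕ) :
    Continuous (energyApprox (d := d) a γ j) := by
  unfold energyApprox
  have := continuous_stressApprox (d := d) (a := a) hγ j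
  fun_prop

theorem energyApprox_mono (hγ : 1 < γ) (z : ℝ × Vec d) :
    Monotone fun j => energyApprox a γ j z := by
  intro j k h
  refine add_le_add (Finset.sum_le_sum fun i _ => ?_) ?_
  · exact mul_le_mul_of_nonneg_left (stressApprox_mono i z h) (energyCoef_pos hγ i).le
  · exact mul_le_mul_of_nonneg_right (by exact_mod_cast h) (le_max_right _ _)

theorem ofReal_cutoff_mul_energyApprox_le (ha : 0 < a) (hγ : 1 < γ) (j : ℕ) (z : ℝ × Vec d) :
    ENNReal.ofReal (cutoff j z * energyApprox a γ j z) ≤ energy a γ z.1 z.2 := by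
  by_cases hz : z ∈ admissible d
  · rw [energy_eq_sum hγ hz]
    refine ENNReal.ofReal_le_ofReal ((mul_le_of_le_one_left (energyApprox_nonneg ha hγ j z)
      (cutoff_le_one j z)).trans ?_)
    rw [energyApprox, max_eq_right (by linarith [nonneg_of_mem_admissible hz]), mul_zero, add_zero]
    exact Finset.sum_le_sum fun i _ =>
      mul_le_mul_of_nonneg_left (stressApprox_le hγ hz j i) (energyCoef_pos hγ i).le
  · rw [energy_eq_top hz]; exact le_top

/-- There are two ways to be inadmissible. A negative density is detected by the penalty `j * max
(-z.1) 0`, momentum in vacuum by the regularized kinetic term, which equals `(j + 1) m_i² / 2`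
there. -/
theorem tendsto_energyApprox_atTop (ha : 0 < a) (hγ : 1 < γ) {z : ℝ × Vec d}
    (hz : z ∉ admissible d) : Tendsto (fun j => energyApprox a γ j z) atTop atTop := by
  simp only [admissible, Set.mem_ofPred_eq, not_or, not_lt] at hz
  obtain ⟨h1, h2⟩ := hz
  rcases h1.lt_or_eq with h | h
  · refine tendsto_atTop_mono (f := fun j : ℕ => (j : ℝ) * max (-z.1) 0) (fun j => ?_) ?_
    · exact le_add_of_nonneg_left (Finset.sum_nonneg fun k _ =>
        mul_nonneg (energyCoef_pos hγ k).le (stressApprox_nonneg ha j k z))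
    · exact tendsto_natCast_atTop_atTop.atTop_mul_const (lt_max_of_lt_left (by linarith))
  · have : ∃ i, z.2 i ≠ 0 := by
      by_contra! h'
      exact h2 (Prod.ext h (by ext i; simpa using h' i))
    obtain ⟨i, hi⟩ := this
    refine tendsto_atTop_mono (f := fun j : ℕ => ((j : ℝ) + 1) * (1 / 2 * z.2 i ^ 2))
      (fun j => ?_) ?_
    · refine le_trans ?_ (le_add_of_nonneg_right (mul_nonneg j.cast_nonneg (le_max_right _ _)))
      refine le_trans (le_of_eq ?_) (Finset.single_le_sum (fun k _ =>
        mul_nonneg (energyCoef_pos hγ k).le (stressApprox_nonneg ha j k z))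
          (Finset.mem_univ (some i)))
      simp only [energyCoef, stressApprox, h, max_self, zero_add]
      field_simp
    · exact (tendsto_natCast_atTop_atTop.atTop_add tendsto_const_nhds).atTop_mul_const
        (by positivity)

/-- (S)-convergence only sees `C_c` functions. Being a countable increasing supremum of such
functions, with the value `⊤` included, the energy is lower semicontinuous under it, and finite
energy of `V y` confines `V y` to admissible states. -/
theorem energy_eq_iSup (ha : 0 < a) (hγ : 1 < γ) (z : ℝ × Vec d) :
    energy a γ z.1 z.2 = ⨆ j, ENNReal.ofReal (cutoff j z * energyApprox a γ j z) := by
  refine le_antisymm ?_ (iSup_le fun j => ofReal_cutoff_mul_energyApprox_le ha hγ j z)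
  have key : Tendsto (fun j => ENNReal.ofReal (cutoff j z * energyApprox a γ j z)) atTop
      (𝓝 (energy a γ z.1 z.2)) := by
    by_cases hz : z ∈ admissible d
    · rw [energy_eq_sum hγ hz]
      refine ENNReal.tendsto_ofReal ?_
      have : Tendsto (fun j => ∑ k, energyCoef γ k * stressApprox a γ j k z) atTop
          (𝓝 (∑ k, energyCoef γ k * stressPart a γ k z)) :=
        tendsto_finsetSum _ fun k _ => (tendsto_stressApprox hγ hz k).const_mul _
      refine this.congr' ?_
      filter_upwards [eventually_cutoff_eq_one z] with j hj
      rw [hj, one_mul, energyApprox, max_eq_right (by linarith [nonneg_of_mem_admissible hz]),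
        mul_zero, add_zero]
    · rw [energy_eq_top hz]
      refine ENNReal.tendsto_ofReal_atTop.comp ((tendsto_energyApprox_atTop ha hγ hz).congr' ?_)
      filter_upwards [eventually_cutoff_eq_one z] with j hj
      rw [hj, one_mul]
  exact le_of_tendsto key (Eventually.of_forall fun j =>
    le_iSup (fun j => ENNReal.ofReal (cutoff j z * energyApprox a γ j z)) j)

theorem monotone_cutoff_mul_energyApprox (ha : 0 < a) (hγ : 1 < γ) (z : ℝ × Vec d) :
    Monotone fun j => cutoff j z * energyApprox a γ j z := fun _ _ h =>
  mul_le_mul (cutoff_mono z h) (energyApprox_mono hγ z h) (energyApprox_nonneg ha hγ _ _)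
    (cutoff_nonneg _ _)

theorem stressPart_le_energy (ha : 0 < a) (hγ : 1 < γ) {z : ℝ × Vec d} (hz : z ∈ admissible d)
    (k : Option (Fin d)) :
    ENNReal.ofReal (stressPart a γ k z)
      ≤ ENNReal.ofReal (energyCoef γ k)⁻¹ * energy a γ z.1 z.2 := by
  have hk := energyCoef_pos hγ k
  rw [energy_eq_sum hγ hz, ← ENNReal.ofReal_mul (by positivity)]
  refine ENNReal.ofReal_le_ofReal ?_
  rw [← div_eq_inv_mul, le_div_iff₀ hk, mul_comm]
  exact Finset.single_le_sum (f := fun k => energyCoef γ k * stressPart a γ k z) (fun k _ =>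
    mul_nonneg (energyCoef_pos hγ k).le (stressPart_nonneg ha (nonneg_of_mem_admissible hz) k))
    (Finset.mem_univ k)

/-- The energy grows faster than linearly. -/
theorem exists_norm_le_energy (ha : 0 < a) (hγ : 1 < γ) {η : ℝ} (hη : 0 < η) :
    ∃ C : ℝ, ∀ z ∈ admissible d,
      ‖z‖ ≤ η * ∑ k, energyCoef γ k * stressPart a γ k z + C := by
  have hγ' : 0 < γ - 1 := sub_pos.2 hγ
  -- Young's inequality `|m| ≤ η |m|² / (2ϱ) + ϱ / (2η)` leaves `K ϱ` to be absorbed by the internal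
  -- energy. This succeeds once `ϱ^(γ-1) ≥ B`, that is for `ϱ ≥ S`; smaller densities cost at most
  -- `K * S`.
  set K : ℝ := 1 + 1 / (2 * η) with hK
  have hKpos : 0 < K := by positivity
  set B : ℝ := K * (γ - 1) / (η * a) with hB
  have hBpos : 0 < B := by positivity
  set S : ℝ := B ^ (1 / (γ - 1)) with hS
  have hSpos : 0 < S := Real.rpow_pos_of_pos hBpos _
  refine ⟨K * S, fun z hz => ?_⟩
  rcases hz with h | rfl
  swap
  · simp only [norm_zero, stressPart_zero hγ, mul_zero, Finset.sum_const_zero, zero_add]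
    positivity
  have hsum : ∑ k, energyCoef γ k * stressPart a γ k z
      = 1 / (γ - 1) * (a * z.1 ^ γ) + 1 / 2 * (‖z.2‖ ^ 2 / z.1) := by
    simp only [if_pos h, Fintype.sum_option, energyCoef, stressPart, pressure, convFlux,
      EuclideanSpace.real_norm_sq_eq, Finset.sum_div, ← Finset.mul_sum, ← pow_two]
  have h1 : ‖z‖ ≤ z.1 + ‖z.2‖ := by
    rw [Prod.norm_def]
    refine max_le ?_ (by linarith)
    rw [Real.norm_of_nonneg h.le]
    linarith [norm_nonneg z.2]
  have h2 : ‖z.2‖ ≤ η * (1 / 2 * (‖z.2‖ ^ 2 / z.1)) + 1 / (2 * η) * z.1 := by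
    have : 0 ≤ (η * ‖z.2‖ - z.1) ^ 2 / (2 * η * z.1) := by positivity
    have h3 : (η * ‖z.2‖ - z.1) ^ 2 / (2 * η * z.1)
        = η * (1 / 2 * (‖z.2‖ ^ 2 / z.1)) + 1 / (2 * η) * z.1 - ‖z.2‖ := by
      field_simp
      ring
    linarith
  have h4 : K * z.1 ≤ η * (1 / (γ - 1) * (a * z.1 ^ γ)) + K * S := by
    have hnn : 0 ≤ z.1 ^ γ := Real.rpow_nonneg h.le _
    rcases le_total z.1 S with hle | hle
    · have : 0 ≤ η * (1 / (γ - 1) * (a * z.1 ^ γ)) := by positivity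
      nlinarith
    · have h5 : B ≤ z.1 ^ (γ - 1) := by
        have := Real.rpow_le_rpow hSpos.le hle hγ'.le
        rwa [hS, ← Real.rpow_mul hBpos.le, one_div, inv_mul_cancel₀ hγ'.ne', Real.rpow_one] at this
      have h6 : z.1 ^ γ = z.1 ^ (γ - 1) * z.1 := by
        rw [← Real.rpow_add_one h.ne']; congr 1; ring
      have h7 : K * z.1 = η * (1 / (γ - 1) * (a * (B * z.1))) := by
        rw [hB]; field_simp
      have h8 : η * (1 / (γ - 1) * (a * (B * z.1))) ≤ η * (1 / (γ - 1) * (a * z.1 ^ γ)) := by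
        rw [h6]
        gcongr
      have : 0 ≤ K * S := by positivity
      linarith
  rw [hsum, mul_add]
  have : K * z.1 = z.1 + 1 / (2 * η) * z.1 := by rw [hK]; ring
  linarith

theorem eventually_one_sub_cutoff_mul_le_energy (ha : 0 < a) (hγ : 1 < γ) {η : ℝ} (hη : 0 < η) :
    ∀ᶠ j : ℕ in atTop, ∀ z : ℝ × Vec d,
      ENNReal.ofReal ((1 + ‖z‖) * (1 - cutoff j z)) ≤ ENNReal.ofReal η * energy a γ z.1 z.2 := by
  -- For `‖z‖ ≥ 2C` half of `‖z‖` absorbs the constant `C`, and for `‖z‖ ≥ 1` one has `1 + ‖z‖ ≤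
  -- 2‖z‖`; each costs a factor two, hence `η / 4`.
  obtain ⟨C, hC⟩ := exists_norm_le_energy (d := d) ha hγ (show 0 < η / 4 by positivity)
  obtain ⟨J, hJ⟩ := exists_nat_ge (max 1 (2 * C))
  filter_upwards [eventually_ge_atTop J] with j hj z
  by_cases hz : z ∈ admissible d
  swap
  · rw [energy_eq_top hz, ENNReal.mul_top (by simpa using hη)]
    exact le_top
  rw [energy_eq_sum hγ hz, ← ENNReal.ofReal_mul hη.le]
  refine ENNReal.ofReal_le_ofReal ?_
  have hnn : 0 ≤ ∑ k, energyCoef γ k * stressPart a γ k z := Finset.sum_nonneg fun k _ =>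
    mul_nonneg (energyCoef_pos hγ k).le (stressPart_nonneg ha (nonneg_of_mem_admissible hz) k)
  rcases le_or_gt ‖z‖ j with h | h
  · rw [cutoff_eq_one h, sub_self, mul_zero]
    positivity
  · have hj' : (J : ℝ) ≤ j := by exact_mod_cast hj
    have h1 : 1 ≤ ‖z‖ := (le_max_left _ _).trans (hJ.trans (hj'.trans h.le))
    have h2 : 2 * C ≤ ‖z‖ := (le_max_right _ _).trans (hJ.trans (hj'.trans h.le))
    have h3 : (1 + ‖z‖) * (1 - cutoff j z) ≤ 1 + ‖z‖ :=
      mul_le_of_le_one_right (by positivity) (by linarith [cutoff_nonneg j z])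
    linarith [hC z hz]

end state

/-! ### Jensen's inequality for the stress -/

theorem _root_.MeasureTheory.Measure.eq_dirac_of_ae_eq {X : Type*} [MeasurableSpace X]
    (ν : Measure X) [IsProbabilityMeasure ν] {c : X} (h : ∀ᵐ z ∂ν, z = c) :
    ν = Measure.dirac c := by
  have h1 : ν.map id = ν.map fun _ => c := Measure.map_congr h
  rwa [Measure.map_id, Measure.map_const, measure_univ, one_smul] at h1

section Jensen

variable {d : ℕ} {a γ : ℝ} {ν : Measure (ℝ × Vec d)}

theorem integral_snd_apply (h2 : Integrable (fun z => z.2) ν) (i : Fin d) :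
    (∫ z, z.2 ∂ν) i = ∫ z, z.2 i ∂ν :=
  ((EuclideanSpace.proj (𝕜 := ℝ) i).integral_comp_comm h2).symm

theorem integrable_snd_apply (h2 : Integrable (fun z => z.2) ν) (i : Fin d) :
    Integrable (fun z => z.2 i) ν :=
  (EuclideanSpace.proj (𝕜 := ℝ) i).integrable_comp h2

theorem eq_zero_of_integral_fst_eq_zero (hadm : ∀ᵐ z ∂ν, z ∈ admissible d)
    (h1 : Integrable (fun z => z.1) ν) (h0 : ∫ z, z.1 ∂ν = 0) : ∀ᵐ z ∂ν, z = 0 := by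
  have hnn : 0 ≤ᵐ[ν] fun z => z.1 := by
    filter_upwards [hadm] with z hz using nonneg_of_mem_admissible hz
  filter_upwards [(integral_eq_zero_iff_of_nonneg_ae hnn h1).1 h0, hadm] with z hz hz'
  rcases hz' with h | h
  · exact absurd hz h.ne'
  · exact h

/-- A vanishing mean of nonnegative densities forces zero density almost surely, and the only
admissible state without density is the vacuum; so the mean momentum vanishes too. -/
theorem mean_mem_admissible (hadm : ∀ᵐ z ∂ν, z ∈ admissible d)
    (h1 : Integrable (fun z => z.1) ν) :
    (∫ z, z.1 ∂ν, ∫ z, z.2 ∂ν) ∈ admissible d := by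
  have hnn : 0 ≤ ∫ z, z.1 ∂ν := integral_nonneg_of_ae (by
    filter_upwards [hadm] with z hz using nonneg_of_mem_admissible hz)
  rcases hnn.lt_or_eq with h | h
  · exact Or.inl h
  · right
    have := eq_zero_of_integral_fst_eq_zero hadm h1 h.symm
    rw [← h]
    refine Prod.ext rfl (integral_eq_zero_of_ae ?_)
    filter_upwards [this] with z hz
    simp [hz]

/-- The kinetic excess over its linearization at the velocity `v`. -/
theorem kinetic_sub_linear {z : ℝ × Vec d} (hz : z ∈ admissible d) (i : Fin d) (v : ℝ) :
    stressPart a γ (some i) z - (2 * v * z.2 i - v ^ 2 * z.1) = (z.2 i - v * z.1) ^ 2 / z.1 := by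
  rcases hz with h | rfl
  · simp only [stressPart, convFlux, if_pos h]
    field_simp
    ring
  · simp [stressPart, convFlux]

/-- The function `2 v m_i - v² ϱ` is the tangent plane of `m_i² / ϱ` along the ray of velocity `v`.
With `v` the quotient of the means, its integral is the kinetic part at the barycenter, so the
Jensen defect becomes the integral of the square in `kinetic_sub_linear`. -/
theorem integral_kinetic_sub_linear [IsProbabilityMeasure ν]
    (hint : ∀ k, Integrable (stressPart a γ k) ν)
    (h1 : Integrable (fun z => z.1) ν) (h2 : Integrable (fun z => z.2) ν)
    (hR : 0 < ∫ z, z.1 ∂ν) (i : Fin d) :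
    ∫ z, (stressPart a γ (some i) z - (2 * ((∫ z, z.2 ∂ν) i / ∫ z, z.1 ∂ν) * z.2 i
      - ((∫ z, z.2 ∂ν) i / ∫ z, z.1 ∂ν) ^ 2 * z.1)) ∂ν
      = ∫ z, stressPart a γ (some i) z ∂ν
        - stressPart a γ (some i) (∫ z, z.1 ∂ν, ∫ z, z.2 ∂ν) := by
  have hlin (v : ℝ) : Integrable (fun z => 2 * v * z.2 i - v ^ 2 * z.1) ν :=
    ((integrable_snd_apply h2 i).const_mul _).sub (h1.const_mul _)
  rw [integral_sub (hint _) (hlin _), integral_sub ((integrable_snd_apply h2 i).const_mul _) (h1.const_mul _),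
    integral_const_mul, integral_const_mul, ← integral_snd_apply h2]
  congr 1
  simp only [stressPart, convFlux, if_pos hR]
  field_simp
  ring

theorem stressPart_mean_le [IsProbabilityMeasure ν] (ha : 0 < a) (hγ : 1 < γ)
    (hadm : ∀ᵐ z ∂ν, z ∈ admissible d) (hint : ∀ k, Integrable (stressPart a γ k) ν)
    (h1 : Integrable (fun z => z.1) ν) (h2 : Integrable (fun z => z.2) ν)
    (k : Option (Fin d)) :
    stressPart a γ k (∫ z, z.1 ∂ν, ∫ z, z.2 ∂ν) ≤ ∫ z, stressPart a γ k z ∂ν := by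
  have hnn : ∀ᵐ z ∂ν, 0 ≤ z.1 := by
    filter_upwards [hadm] with z hz using nonneg_of_mem_admissible hz
  rcases mean_mem_admissible hadm h1 with hR | hR
  swap
  · rw [hR, stressPart_zero hγ]
    refine integral_nonneg_of_ae ?_
    filter_upwards [hnn] with z hz using stressPart_nonneg ha hz k
  cases k with
  | none =>
    simp only [stressPart, pressure, integral_const_mul]
    refine mul_le_mul_of_nonneg_left ?_ ha.le
    have hi : Integrable (fun z : ℝ × Vec d => z.1 ^ γ) ν := by
      have := (hint none).const_mul a⁻¹
      simpa [stressPart, pressure, ha.ne'] using this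
    exact (convexOn_rpow hγ.le).map_integral_le
      (continuousOn_id.rpow_const fun x _ => Or.inr (by linarith)) isClosed_Ici hnn h1 hi
  | some i =>
    have key := integral_kinetic_sub_linear hint h1 h2 hR i
    have : 0 ≤ ∫ z, (stressPart a γ (some i) z - (2 * ((∫ z, z.2 ∂ν) i / ∫ z, z.1 ∂ν) * z.2 i
      - ((∫ z, z.2 ∂ν) i / ∫ z, z.1 ∂ν) ^ 2 * z.1)) ∂ν := by
      refine integral_nonneg_of_ae ?_
      filter_upwards [hadm] with z hz
      rw [kinetic_sub_linear hz]
      exact div_nonneg (sq_nonneg _) (nonneg_of_mem_admissible hz)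
    linarith

/-- Equality in Jensen's inequality for all parts of the stress forces a Dirac mass. -/
theorem eq_dirac_of_stressPart_mean_eq [IsProbabilityMeasure ν] (ha : 0 < a) (hγ : 1 < γ)
    (hadm : ∀ᵐ z ∂ν, z ∈ admissible d) (hint : ∀ k, Integrable (stressPart a γ k) ν)
    (h1 : Integrable (fun z => z.1) ν) (h2 : Integrable (fun z => z.2) ν)
    (heq : ∀ k, ∫ z, stressPart a γ k z ∂ν = stressPart a γ k (∫ z, z.1 ∂ν, ∫ z, z.2 ∂ν)) :
    ν = Measure.dirac (∫ z, z.1 ∂ν, ∫ z, z.2 ∂ν) := by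
  have hnn : ∀ᵐ z ∂ν, 0 ≤ z.1 := by
    filter_upwards [hadm] with z hz using nonneg_of_mem_admissible hz
  refine ν.eq_dirac_of_ae_eq ?_
  rcases mean_mem_admissible hadm h1 with hR | hR
  swap
  · rw [hR]
    exact eq_zero_of_integral_fst_eq_zero hadm h1 (congrArg Prod.fst hR)
  -- The density has to come first: the kinetic part is homogeneous of degree one, so equality there
  -- fixes only the velocity `m_i / ϱ`. The density follows from strict convexity of `ϱ^γ`.
  have hfst : ∀ᵐ z ∂ν, z.1 = ∫ z, z.1 ∂ν := by
    have hi : Integrable (fun z : ℝ × Vec d => z.1 ^ γ) ν := by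
      have := (hint none).const_mul a⁻¹
      simpa [stressPart, pressure, ha.ne'] using this
    have := (strictConvexOn_rpow hγ).ae_eq_const_or_map_average_lt
      (continuousOn_id.rpow_const fun x _ => Or.inr (by linarith)) isClosed_Ici hnn h1 hi
    simp only [average_eq_integral] at this
    rcases this with h | h
    · exact h
    · have h' := heq none
      simp only [stressPart, pressure, integral_const_mul] at h'
      exact absurd (mul_left_cancel₀ ha.ne' h') h.ne'
  have hsnd : ∀ i, ∀ᵐ z ∂ν, z.2 i = (∫ z, z.2 ∂ν) i := by
    intro i
    have key := integral_kinetic_sub_linear hint h1 h2 hR i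
    rw [heq, sub_self, integral_eq_zero_iff_of_nonneg_ae] at key
    · filter_upwards [key, hadm, hfst] with z hz hz' hz1
      rw [kinetic_sub_linear hz', hz1] at hz
      have h3 : (z.2 i - (∫ z, z.2 ∂ν) i / (∫ z, z.1 ∂ν) * ∫ z, z.1 ∂ν) ^ 2 = 0 := by
        have := (div_eq_zero_iff.1 hz).resolve_right hR.ne'
        exact this
      have h4 := pow_eq_zero_iff (two_ne_zero) |>.1 h3
      rw [div_mul_cancel₀ _ hR.ne'] at h4
      linarith
    · filter_upwards [hadm] with z hz
      rw [kinetic_sub_linear hz]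
      exact div_nonneg (sq_nonneg _) (nonneg_of_mem_admissible hz)
    · exact (hint _).sub (((integrable_snd_apply h2 i).const_mul _).sub (h1.const_mul _))
  filter_upwards [hfst, ae_all_iff.2 hsnd] with z hz hz'
  exact Prod.ext hz (by ext i; exact hz' i)

end Jensen

set_option linter.unusedSectionVars false

/-! ### Limits of Cesàro means along an (S)-convergent sequence -/

section lsc

variable {Y X : Type*} [MeasurableSpace Y] [TopologicalSpace X] [MeasurableSpace X]
  [OpensMeasurableSpace X] {μ : Measure Y} {U : ℕ → Y → X} {V : Y → Measure X}

theorem IsParametrizedMeasure.ae_isFiniteMeasure (hV : IsParametrizedMeasure μ V) :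
    ∀ᵐ y ∂μ, IsFiniteMeasure (V y) := by
  obtain ⟨C, hC⟩ := hV.2
  filter_upwards [hC] with y hy using ⟨hy.trans_lt ENNReal.coe_lt_top⟩

theorem IsParametrizedMeasure.exists_norm_integral_le (hV : IsParametrizedMeasure μ V) {b : X → ℝ}
    (hb : Continuous b) (hbs : HasCompactSupport b) :
    ∃ K : ℝ, ∀ᵐ y ∂μ, ‖∫ z, b z ∂V y‖ ≤ K := by
  obtain ⟨C, hC⟩ := hV.2
  obtain ⟨B, hB⟩ := hbs.exists_bound_of_continuous hb
  refine ⟨|B| * C, ?_⟩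
  filter_upwards [hC] with y hy
  have hfin : IsFiniteMeasure (V y) := ⟨hy.trans_lt ENNReal.coe_lt_top⟩
  refine (norm_integral_le_of_norm_le_const
    (Eventually.of_forall fun z => (hB z).trans (le_abs_self B))).trans ?_
  exact mul_le_mul_of_nonneg_left (ENNReal.toReal_mono ENNReal.coe_ne_top hy) (abs_nonneg B)

theorem IsParametrizedMeasure.integrable_mul_integral (hV : IsParametrizedMeasure μ V)
    {w : Y → ℝ} (hw : Integrable w μ) {b : X → ℝ} (hb : Continuous b)
    (hbs : HasCompactSupport b) : Integrable (fun y => w y * ∫ z, b z ∂V y) μ := by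
  obtain ⟨K, hK⟩ := hV.exists_norm_integral_le hb hbs
  exact hw.mul_bdd (hV.1 b hb hbs) hK

theorem IsParametrizedMeasure.lintegral_ofReal_eq (hV : IsParametrizedMeasure μ V) {b : X → ℝ}
    (hb : Continuous b) (hbs : HasCompactSupport b) (hb0 : ∀ z, 0 ≤ b z) :
    ∀ᵐ y ∂μ, ∫⁻ z, ENNReal.ofReal (b z) ∂V y = ENNReal.ofReal (∫ z, b z ∂V y) := by
  filter_upwards [hV.ae_isFiniteMeasure] with y hy
  exact (ofReal_integral_eq_lintegral_ofReal (hb.integrable_of_hasCompactSupport hbs)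
    (Eventually.of_forall hb0)).symm

theorem IsParametrizedMeasure.aemeasurable_lintegral (hV : IsParametrizedMeasure μ V) {b : X → ℝ}
    (hb : Continuous b) (hbs : HasCompactSupport b) (hb0 : ∀ z, 0 ≤ b z) :
    AEMeasurable (fun y => ∫⁻ z, ENNReal.ofReal (b z) ∂V y) μ :=
  (hV.1 b hb hbs).aemeasurable.ennreal_ofReal.congr
    ((hV.lintegral_ofReal_eq hb hbs hb0).mono fun _ h => h.symm)

theorem lintegral_iSup_ofReal {ρ : Measure X} {b : ℕ → X → ℝ} (hb : ∀ j, Continuous (b j))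
    (hbm : ∀ z, Monotone fun j => b j z) :
    ∫⁻ z, ⨆ j, ENNReal.ofReal (b j z) ∂ρ = ⨆ j, ∫⁻ z, ENNReal.ofReal (b j z) ∂ρ :=
  lintegral_iSup (fun j => (hb j).measurable.ennreal_ofReal)
    fun _ _ h z => ENNReal.ofReal_le_ofReal (hbm z h)

theorem IsParametrizedMeasure.aemeasurable_lintegral_iSup (hV : IsParametrizedMeasure μ V)
    {b : ℕ → X → ℝ} (hb : ∀ j, Continuous (b j)) (hbs : ∀ j, HasCompactSupport (b j))
    (hb0 : ∀ j z, 0 ≤ b j z) (hbm : ∀ z, Monotone fun j => b j z) :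
    AEMeasurable (fun y => ∫⁻ z, ⨆ j, ENNReal.ofReal (b j z) ∂V y) μ := by
  simp only [lintegral_iSup_ofReal hb hbm]
  exact AEMeasurable.iSup fun j => hV.aemeasurable_lintegral (hb j) (hbs j) (hb0 j)

/-- Lower semicontinuity of integral functionals along Cesàro means. -/
theorem SConvergesTo.lintegral_iSup_le {ι : Type*} [Fintype ι] (hS : SConvergesTo μ U V)
    {w : ι → Y → ℝ} (hw : ∀ k, Integrable (w k) μ) (hw0 : ∀ᵐ y ∂μ, ∀ k, 0 ≤ w k y)
    {b : ι → ℕ → X → ℝ} (hb : ∀ k j, Continuous (b k j)) (hbs : ∀ k j, HasCompactSupport (b k j))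
    (hb0 : ∀ k j z, 0 ≤ b k j z) (hbm : ∀ k z, Monotone fun j => b k j z)
    {F : ℕ → Y → ℝ} (hF : ∀ n, Integrable (F n) μ)
    (hbF : ∀ j n, ∀ᵐ y ∂μ, ∑ k, w k y * b k j (U n y) ≤ F n y)
    {S : ℕ → ℝ} {L : ℝ} (hSL : Tendsto S atTop (𝓝 L))
    (hFS : ∀ N : ℕ, (N : ℝ)⁻¹ * ∑ n ∈ Finset.range N, ∫ y, F n y ∂μ ≤ S N) :
    ∫⁻ y, ∑ k, ENNReal.ofReal (w k y) * ∫⁻ z, ⨆ j, ENNReal.ofReal (b k j z) ∂V y ∂μ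
      ≤ ENNReal.ofReal L := by
  have hV := hS.isParametrizedMeasure
  have hint (j : ℕ) (k : ι) := hV.integrable_mul_integral (hw k) (hb k j) (hbs k j)
  have hintU (j n : ℕ) (k : ι) : Integrable (fun y => w k y * b k j (U n y)) μ := by
    obtain ⟨B, hB⟩ := (hbs k j).exists_bound_of_continuous (hb k j)
    exact (hw k).mul_bdd ((hb k j).measurable.comp_aemeasurable
      (hS.weaklySConvergent.1 n)).aestronglyMeasurable (Eventually.of_forall fun y => hB _)
  have hmean (j N : ℕ) : ∑ k, ∫ y, w k y *
      ((N : ℝ)⁻¹ * ∑ n ∈ Finset.range N, b k j (U n y)) ∂μ ≤ S N := by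
    refine le_trans ?_ (hFS N)
    have h1 (k : ι) : ∫ y, w k y * ((N : ℝ)⁻¹ * ∑ n ∈ Finset.range N, b k j (U n y)) ∂μ
        = (N : ℝ)⁻¹ * ∑ n ∈ Finset.range N, ∫ y, w k y * b k j (U n y) ∂μ := by
      rw [← integral_finsetSum _ fun n _ => hintU j n k, ← integral_const_mul]
      congr 1 with y
      rw [← Finset.mul_sum, mul_left_comm]
    simp only [h1]
    rw [← Finset.mul_sum, Finset.sum_comm]
    refine mul_le_mul_of_nonneg_left (Finset.sum_le_sum fun n _ => ?_) (by positivity)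
    rw [← integral_finsetSum _ fun k _ => hintU j n k]
    exact integral_mono_ae (integrable_finsetSum _ fun k _ => hintU j n k) (hF n) (hbF j n)
  -- The limit in `N` is taken at fixed `j`, where `b k j` has compact support and (S)-convergence
  -- applies; monotone convergence in `j` follows afterwards.
  have hle (j : ℕ) : ∑ k, ∫ y, w k y * ∫ z, b k j z ∂V y ∂μ ≤ L :=
    le_of_tendsto_of_tendsto' (tendsto_finsetSum _ fun k _ =>
      hS.tendsto (b k j) (hb k j) (hbs k j) (w k) (hw k)) hSL (hmean j)
  have hmono (y : Y) (k : ι) : Monotone fun j =>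
      ENNReal.ofReal (w k y) * ∫⁻ z, ENNReal.ofReal (b k j z) ∂V y := fun j l hjl =>
    mul_le_mul_right (lintegral_mono fun z => ENNReal.ofReal_le_ofReal (hbm k z hjl)) _
  have hsup (y : Y) : ∑ k, ENNReal.ofReal (w k y) * ∫⁻ z, ⨆ j, ENNReal.ofReal (b k j z) ∂V y
      = ⨆ j, ∑ k, ENNReal.ofReal (w k y) * ∫⁻ z, ENNReal.ofReal (b k j z) ∂V y := by
    rw [← ENNReal.finsetSum_iSup_of_monotone fun k => hmono y k]
    refine Finset.sum_congr rfl fun k _ => ?_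
    rw [lintegral_iSup_ofReal (hb k) (hbm k), ENNReal.mul_iSup]
  simp only [hsup]
  rw [lintegral_iSup']
  · refine iSup_le fun j => ?_
    have h1 : ∫⁻ y, ∑ k, ENNReal.ofReal (w k y) * ∫⁻ z, ENNReal.ofReal (b k j z) ∂V y ∂μ
        = ∫⁻ y, ENNReal.ofReal (∑ k, w k y * ∫ z, b k j z ∂V y) ∂μ := by
      refine lintegral_congr_ae ?_
      have := ae_all_iff.2 fun k => hV.lintegral_ofReal_eq (hb k j) (hbs k j) (hb0 k j)
      filter_upwards [this, hw0] with y hy hw0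
      rw [ENNReal.ofReal_sum_of_nonneg fun k _ =>
        mul_nonneg (hw0 k) (integral_nonneg (hb0 k j))]
      refine Finset.sum_congr rfl fun k _ => ?_
      rw [hy k, ENNReal.ofReal_mul (hw0 k)]
    rw [h1, ← ofReal_integral_eq_lintegral_ofReal (integrable_finsetSum _ fun k _ => hint j k)
      (hw0.mono fun y hw0 => Finset.sum_nonneg fun k _ =>
        mul_nonneg (hw0 k) (integral_nonneg (hb0 k j))),
      integral_finsetSum _ fun k _ => hint j k]
    exact ENNReal.ofReal_le_ofReal (hle j)
  · intro j
    refine Finset.aemeasurable_fun_sum _ fun k _ => ?_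
    exact (hw k).aemeasurable.ennreal_ofReal.mul
      (hV.aemeasurable_lintegral (hb k j) (hbs k j) (hb0 k j))
  · exact Eventually.of_forall fun y j l hjl => Finset.sum_le_sum fun k _ => hmono y k hjl

end lsc

/-! ### Functions of linear growth -/

section growth

variable {Y X : Type*} [MeasurableSpace Y] [NormedAddCommGroup X] [MeasurableSpace X]
  [BorelSpace X] {μ : Measure Y} {U : ℕ → Y → X} {V : Y → Measure X}

/-- `Ψ` dominates the tails of functions of linear growth. -/
def IsSuperlinear (Ψ : X → ℝ≥0∞) : Prop :=
  ∀ η : ℝ, 0 < η → ∀ᶠ j : ℕ in atTop, ∀ z : X,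
    ENNReal.ofReal ((1 + ‖z‖) * (1 - cutoff j z)) ≤ ENNReal.ofReal η * Ψ z

theorem enorm_mul_sub_cutoff_mul_le {Ψ : X → ℝ≥0∞} {η : ℝ} {j : ℕ}
    (hj : ∀ z : X, ENNReal.ofReal ((1 + ‖z‖) * (1 - cutoff j z)) ≤ ENNReal.ofReal η * Ψ z)
    {g : X → ℝ} (hg : ∀ z, |g z| ≤ 1 + ‖z‖) {w B : ℝ} (hw : |w| ≤ B) (z : X) :
    ‖w * g z - w * (cutoff j z * g z)‖ₑ ≤ ENNReal.ofReal (B * η) * Ψ z := by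
  have hB : 0 ≤ B := (abs_nonneg _).trans hw
  rw [ENNReal.ofReal_mul hB, mul_assoc, ← ofReal_norm]
  refine le_trans ?_ (mul_le_mul_right (hj z) _)
  rw [← ENNReal.ofReal_mul hB]
  refine ENNReal.ofReal_le_ofReal ?_
  have h1 : 0 ≤ 1 - cutoff j z := sub_nonneg.2 (cutoff_le_one j z)
  have : w * g z - w * (cutoff j z * g z) = w * (g z * (1 - cutoff j z)) := by ring
  rw [this, norm_mul, norm_mul, Real.norm_eq_abs, Real.norm_eq_abs, Real.norm_of_nonneg h1]
  exact mul_le_mul hw (mul_le_mul_of_nonneg_right (hg z) h1)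
    (mul_nonneg (abs_nonneg _) h1) hB

theorem integrable_comp_of_isSuperlinear {Ψ : X → ℝ≥0∞} (hΨ : IsSuperlinear Ψ) {ρ : Measure Y}
    [IsFiniteMeasure ρ] {f : Y → X} (hf : AEMeasurable f ρ) (hfin : ∫⁻ y, Ψ (f y) ∂ρ ≠ ⊤)
    {g : X → ℝ} (hgc : Continuous g) (hg : ∀ z, |g z| ≤ 1 + ‖z‖) :
    Integrable (fun y => g (f y)) ρ := by
  obtain ⟨j, hj⟩ := (hΨ 1 one_pos).exists
  refine ⟨(hgc.measurable.comp_aemeasurable hf).aestronglyMeasurable, ?_⟩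
  -- On the ball of radius `j + 1` linear growth is at most `j + 2`. Beyond it the cutoff is zero
  -- and the tail bound with `η = 1` applies.
  have key (z : X) : ‖g z‖ₑ ≤ ENNReal.ofReal (j + 2) + Ψ z := by
    have h2 := hj z
    rw [ENNReal.ofReal_one, one_mul] at h2
    refine le_trans ?_ (add_le_add_right h2 _)
    rw [← ENNReal.ofReal_add (by positivity) (mul_nonneg (by positivity)
      (sub_nonneg.2 (cutoff_le_one j z))), ← ofReal_norm]
    refine ENNReal.ofReal_le_ofReal ((hg z).trans ?_)
    rcases le_or_gt ‖z‖ (j + 1) with h | h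
    · have : 0 ≤ (1 + ‖z‖) * (1 - cutoff j z) := mul_nonneg (by positivity)
        (sub_nonneg.2 (cutoff_le_one j z))
      linarith
    · have : cutoff j z = 0 := by
        unfold cutoff
        exact max_eq_left ((min_le_right _ _).trans (by linarith))
      rw [this]
      have : (0 : ℝ) ≤ j := j.cast_nonneg
      linarith
  refine (lintegral_mono fun y => key (f y)).trans_lt ?_
  rw [lintegral_add_left measurable_const, lintegral_const]
  exact ENNReal.add_lt_top.2 ⟨ENNReal.mul_lt_top ENNReal.ofReal_lt_top (measure_lt_top _ _),
    hfin.lt_top⟩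

theorem continuous_cutoff_mul (j : ℕ) {g : X → ℝ} (hgc : Continuous g) :
    Continuous fun z => cutoff j z * g z :=
  (continuous_cutoff j).mul hgc

theorem abs_cutoff_mul_le (j : ℕ) {g : X → ℝ} (hg : ∀ z, |g z| ≤ 1 + ‖z‖) (z : X) :
    |cutoff j z * g z| ≤ 1 + ‖z‖ := by
  rw [abs_mul, abs_of_nonneg (cutoff_nonneg j z)]
  exact (mul_le_of_le_one_left (abs_nonneg _) (cutoff_le_one j z)).trans (hg z)

/-- The truncation error depends on `f` only through the integral of `Ψ ∘ f`. The form with a map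
and a weight serves both the fields `U n` and, with `f = id` and `w = 1`, the measures `V y`. -/
theorem norm_integral_sub_cutoff_le {Ψ : X → ℝ≥0∞} (hΨ : IsSuperlinear Ψ) {η : ℝ} (hη : 0 < η)
    {j : ℕ} (hj : ∀ z : X, ENNReal.ofReal ((1 + ‖z‖) * (1 - cutoff j z)) ≤ ENNReal.ofReal η * Ψ z)
    {ρ : Measure Y} [IsFiniteMeasure ρ] {f : Y → X} (hf : AEMeasurable f ρ)
    (hfin : ∫⁻ y, Ψ (f y) ∂ρ ≠ ⊤) {g : X → ℝ} (hgc : Continuous g) (hg : ∀ z, |g z| ≤ 1 + ‖z‖)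
    {w : Y → ℝ} (hwm : AEStronglyMeasurable w ρ) {B : ℝ} (hw : ∀ y, |w y| ≤ B) (hB : 0 ≤ B) :
    ‖∫ y, w y * g (f y) ∂ρ - ∫ y, w y * (cutoff j (f y) * g (f y)) ∂ρ‖
      ≤ B * η * (∫⁻ y, Ψ (f y) ∂ρ).toReal := by
  have hi1 : Integrable (fun y => w y * g (f y)) ρ :=
    (integrable_comp_of_isSuperlinear hΨ hf hfin hgc hg).bdd_mul hwm (Eventually.of_forall hw)
  have hi2 : Integrable (fun y => w y * (cutoff j (f y) * g (f y))) ρ :=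
    (integrable_comp_of_isSuperlinear hΨ hf hfin (continuous_cutoff_mul j hgc)
      (abs_cutoff_mul_le j hg)).bdd_mul hwm (Eventually.of_forall hw)
  rw [← integral_sub hi1 hi2, ← toReal_enorm, ← ENNReal.toReal_ofReal (mul_nonneg hB hη.le),
    ← ENNReal.toReal_mul]
  refine ENNReal.toReal_mono (ENNReal.mul_ne_top ENNReal.ofReal_ne_top hfin)
    ((enorm_integral_le_lintegral_enorm _).trans ?_)
  rw [← lintegral_const_mul' _ _ ENNReal.ofReal_ne_top]
  exact lintegral_mono fun y => enorm_mul_sub_cutoff_mul_le hj hg (hw y) (f y)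

variable [ProperSpace X]

theorem hasCompactSupport_cutoff_mul (j : ℕ) (g : X → ℝ) :
    HasCompactSupport fun z => cutoff j z * g z :=
  (hasCompactSupport_cutoff j).mul_right

theorem enorm_integral_sub_cutoff_le {Ψ : X → ℝ≥0∞} (hΨ : IsSuperlinear Ψ) {η : ℝ} (hη : 0 < η)
    {j : ℕ} (hj : ∀ z : X, ENNReal.ofReal ((1 + ‖z‖) * (1 - cutoff j z)) ≤ ENNReal.ofReal η * Ψ z)
    {ν : Measure X} [IsFiniteMeasure ν] (hfin : ∫⁻ z, Ψ z ∂ν ≠ ⊤)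
    {g : X → ℝ} (hgc : Continuous g) (hg : ∀ z, |g z| ≤ 1 + ‖z‖) :
    ‖∫ z, g z ∂ν - ∫ z, cutoff j z * g z ∂ν‖ₑ ≤ ENNReal.ofReal η * ∫⁻ z, Ψ z ∂ν := by
  have := norm_integral_sub_cutoff_le (ρ := ν) (f := id) (w := fun _ => 1) (B := 1) hΨ hη hj
    aemeasurable_id hfin hgc hg aestronglyMeasurable_const (by simp) zero_le_one
  simp only [one_mul, id] at this
  rw [← ofReal_norm]
  refine (ENNReal.ofReal_le_ofReal this).trans ?_
  rw [ENNReal.ofReal_mul hη.le, ENNReal.ofReal_toReal hfin]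

/-- Measurability in `y` is part of the definition only for `C_c` integrands; truncation and
dominated convergence extend it to linear growth. -/
theorem IsParametrizedMeasure.aestronglyMeasurable_integral {Ψ : X → ℝ≥0∞} (hΨ : IsSuperlinear Ψ)
    (hV : IsParametrizedMeasure μ V) (hfin : ∀ᵐ y ∂μ, ∫⁻ z, Ψ z ∂V y ≠ ⊤)
    {g : X → ℝ} (hgc : Continuous g) (hg : ∀ z, |g z| ≤ 1 + ‖z‖) :
    AEStronglyMeasurable (fun y => ∫ z, g z ∂V y) μ := by
  refine aestronglyMeasurable_of_tendsto_ae atTop (f := fun j y => ∫ z, cutoff j z * g z ∂V y)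
    (fun j => hV.1 _ (continuous_cutoff_mul j hgc) (hasCompactSupport_cutoff_mul j g)) ?_
  filter_upwards [hfin, hV.ae_isFiniteMeasure] with y hy _
  refine tendsto_integral_of_dominated_convergence (fun z => |g z|)
    (fun j => (continuous_cutoff_mul j hgc).aestronglyMeasurable)
    (integrable_comp_of_isSuperlinear (f := id) hΨ aemeasurable_id hy hgc hg).abs
    (fun j => Eventually.of_forall fun z => ?_) (Eventually.of_forall fun z => ?_)
  · rw [norm_mul, Real.norm_of_nonneg (cutoff_nonneg j z)]
    exact mul_le_of_le_one_left (norm_nonneg _) (cutoff_le_one j z)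
  · refine tendsto_const_nhds.congr' ?_
    filter_upwards [eventually_cutoff_eq_one z] with j hj
    rw [hj, one_mul]

theorem IsParametrizedMeasure.integrable_integral [IsFiniteMeasure μ] {Ψ : X → ℝ≥0∞}
    (hΨ : IsSuperlinear Ψ) (hV : IsParametrizedMeasure μ V)
    (hm : AEMeasurable (fun y => ∫⁻ z, Ψ z ∂V y) μ) (hfin : ∫⁻ y, ∫⁻ z, Ψ z ∂V y ∂μ ≠ ⊤)
    {g : X → ℝ} (hgc : Continuous g) (hg : ∀ z, |g z| ≤ 1 + ‖z‖) :
    Integrable (fun y => ∫ z, g z ∂V y) μ := by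
  have hfin' : ∀ᵐ y ∂μ, ∫⁻ z, Ψ z ∂V y ≠ ⊤ := by
    filter_upwards [ae_lt_top' hm hfin] with y hy using hy.ne
  obtain ⟨j, hj⟩ := (hΨ 1 one_pos).exists
  have h1 := hV.integrable_mul_integral (integrable_const (1 : ℝ)) (continuous_cutoff_mul j hgc)
    (hasCompactSupport_cutoff_mul j g)
  simp only [one_mul] at h1
  have h2 : Integrable (fun y => ∫ z, g z ∂V y - ∫ z, cutoff j z * g z ∂V y) μ := by
    refine ⟨(hV.aestronglyMeasurable_integral hΨ hfin' hgc hg).sub h1.1, ?_⟩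
    refine lt_of_le_of_lt (lintegral_mono_ae ?_) hfin.lt_top
    filter_upwards [hfin', hV.ae_isFiniteMeasure] with y hy _
    simpa using enorm_integral_sub_cutoff_le hΨ one_pos hj hy hgc hg
  exact (h2.add h1).congr (Eventually.of_forall fun y => sub_add_cancel _ _)

/-- Convergence of the Cesàro means of functions of linear growth. -/
theorem SConvergesTo.tendsto_integral_of_isSuperlinear [IsFiniteMeasure μ]
    (hS : SConvergesTo μ U V) {Ψ : X → ℝ≥0∞} (hΨ : IsSuperlinear Ψ)
    (hm : AEMeasurable (fun y => ∫⁻ z, Ψ z ∂V y) μ) {C : ℝ≥0}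
    (hUC : ∀ n, ∫⁻ y, Ψ (U n y) ∂μ ≤ C) (hVC : ∫⁻ y, ∫⁻ z, Ψ z ∂V y ∂μ ≤ C)
    {g : X → ℝ} (hgc : Continuous g) (hg : ∀ z, |g z| ≤ 1 + ‖z‖)
    {w : Y → ℝ} (hwm : AEStronglyMeasurable w μ) {B : ℝ} (hw : ∀ y, |w y| ≤ B) :
    Tendsto (fun N : ℕ => (N : ℝ)⁻¹ * ∑ n ∈ Finset.range N, ∫ y, w y * g (U n y) ∂μ) atTop
      (𝓝 (∫ y, w y * ∫ z, g z ∂V y ∂μ)) := by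
  have hV := hS.isParametrizedMeasure
  rcases isEmpty_or_nonempty Y with hY | ⟨⟨y₀⟩⟩
  · simp [Measure.eq_zero_of_isEmpty μ]
  have hB : 0 ≤ B := (abs_nonneg _).trans (hw y₀)
  have hVtop : ∫⁻ y, ∫⁻ z, Ψ z ∂V y ∂μ ≠ ⊤ := ne_top_of_le_ne_top ENNReal.coe_ne_top hVC
  have hUtop (n) : ∫⁻ y, Ψ (U n y) ∂μ ≠ ⊤ := ne_top_of_le_ne_top ENNReal.coe_ne_top (hUC n)
  have hUm := hS.weaklySConvergent.1
  have hwi : Integrable w μ :=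
    Integrable.of_bound hwm B (Eventually.of_forall hw)
  rw [Metric.tendsto_atTop]
  intro ε hε
  -- Three errors of size `ε / 3`: truncation along the sequence, (S)-convergence of the truncated
  -- function, truncation under `V`. The summand `1` covers the case `B * C = 0`.
  set η : ℝ := ε / (3 * (B * C + 1)) with hη'
  have hBC : 0 ≤ B * C := mul_nonneg hB C.2
  have hη : 0 < η := by positivity
  have hsmall : B * η * C < ε / 3 := by
    have : B * η * C = ε / 3 * (B * C / (B * C + 1)) := by
      rw [hη']; field_simp
    rw [this]
    refine mul_lt_of_lt_one_right (by positivity) ?_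
    rw [div_lt_one (by positivity)]
    linarith
  obtain ⟨j, hj⟩ := (hΨ η hη).exists
  have hgj := continuous_cutoff_mul j hgc
  have hgs := hasCompactSupport_cutoff_mul j g
  have hlim := hS.tendsto _ hgj hgs w hwi
  rw [Metric.tendsto_atTop] at hlim
  obtain ⟨N₀, hN₀⟩ := hlim (ε / 3) (by positivity)
  refine ⟨N₀, fun N hN => ?_⟩
  have hmean : ∫ y, w y * ((N : ℝ)⁻¹ * ∑ n ∈ Finset.range N, cutoff j (U n y) * g (U n y)) ∂μ
      = (N : ℝ)⁻¹ * ∑ n ∈ Finset.range N, ∫ y, w y * (cutoff j (U n y) * g (U n y)) ∂μ := by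
    have hi (n : ℕ) : Integrable (fun y => w y * (cutoff j (U n y) * g (U n y))) μ :=
      (integrable_comp_of_isSuperlinear hΨ (hUm n) (hUtop n) hgj
        (abs_cutoff_mul_le j hg)).bdd_mul hwm (Eventually.of_forall hw)
    rw [← integral_finsetSum _ fun n _ => hi n, ← integral_const_mul]
    congr 1 with y
    rw [Finset.mul_sum, Finset.mul_sum, Finset.mul_sum]
    exact Finset.sum_congr rfl fun n _ => by ring
  have h1 : dist ((N : ℝ)⁻¹ * ∑ n ∈ Finset.range N, ∫ y, w y * g (U n y) ∂μ)
      (∫ y, w y * ((N : ℝ)⁻¹ * ∑ n ∈ Finset.range N, cutoff j (U n y) * g (U n y)) ∂μ)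
      ≤ B * η * C := by
    rw [hmean, dist_eq_norm, ← mul_sub, ← Finset.sum_sub_distrib, norm_mul, norm_inv,
      RCLike.norm_natCast]
    rcases N.eq_zero_or_pos with rfl | hNpos
    · simp only [Nat.cast_zero, inv_zero, zero_mul]
      exact mul_nonneg (mul_nonneg hB hη.le) C.2
    have hN' : (0 : ℝ) < N := by exact_mod_cast hNpos
    rw [inv_mul_le_iff₀ hN']
    refine (norm_sum_le _ _).trans ((Finset.sum_le_card_nsmul _ _ (B * η * C) fun n _ => ?_).trans
      (by simp))
    refine (norm_integral_sub_cutoff_le hΨ hη hj (hUm n) (hUtop n) hgc hg hwm hw hB).trans ?_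
    exact mul_le_mul_of_nonneg_left (ENNReal.toReal_mono ENNReal.coe_ne_top (hUC n))
      (mul_nonneg hB hη.le)
  have h2 : dist (∫ y, w y * ∫ z, cutoff j z * g z ∂V y ∂μ) (∫ y, w y * ∫ z, g z ∂V y ∂μ)
      ≤ B * η * C := by
    rw [dist_comm, dist_eq_norm, ← integral_sub
      ((hV.integrable_integral hΨ hm hVtop hgc hg).bdd_mul hwm (Eventually.of_forall hw))
      (hV.integrable_mul_integral hwi hgj hgs), ← toReal_enorm,
      ← ENNReal.toReal_ofReal (mul_nonneg hB hη.le), ← ENNReal.coe_toReal, ← ENNReal.toReal_mul]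
    refine ENNReal.toReal_mono (ENNReal.mul_ne_top ENNReal.ofReal_ne_top ENNReal.coe_ne_top)
      ((enorm_integral_le_lintegral_enorm _).trans ?_)
    refine le_trans ?_ (mul_le_mul_right hVC _)
    rw [← lintegral_const_mul' _ _ ENNReal.ofReal_ne_top]
    refine lintegral_mono_ae ?_
    filter_upwards [ae_lt_top' hm hVtop, hV.ae_isFiniteMeasure] with y hy _
    rw [← mul_sub, enorm_mul, ENNReal.ofReal_mul hB, mul_assoc]
    refine mul_le_mul' ?_ (enorm_integral_sub_cutoff_le hΨ hη hj hy.ne hgc hg)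
    rw [← ofReal_norm]
    exact ENNReal.ofReal_le_ofReal (hw y)
  have h3 := hN₀ N hN
  have := dist_triangle4 ((N : ℝ)⁻¹ * ∑ n ∈ Finset.range N, ∫ y, w y * g (U n y) ∂μ)
    (∫ y, w y * ((N : ℝ)⁻¹ * ∑ n ∈ Finset.range N, cutoff j (U n y) * g (U n y)) ∂μ)
    (∫ y, w y * ∫ z, cutoff j z * g z ∂V y ∂μ) (∫ y, w y * ∫ z, g z ∂V y ∂μ)
  linarith

/-- Under a uniform superlinear bound no mass escapes to infinity. -/
theorem SConvergesTo.ae_isProbabilityMeasure [IsFiniteMeasure μ]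
    (hS : SConvergesTo μ U V) {Ψ : X → ℝ≥0∞} (hΨ : IsSuperlinear Ψ)
    (hm : AEMeasurable (fun y => ∫⁻ z, Ψ z ∂V y) μ) {C : ℝ≥0}
    (hUC : ∀ n, ∫⁻ y, Ψ (U n y) ∂μ ≤ C) (hVC : ∫⁻ y, ∫⁻ z, Ψ z ∂V y ∂μ ≤ C) :
    ∀ᵐ y ∂μ, IsProbabilityMeasure (V y) := by
  have hV := hS.isParametrizedMeasure
  have hone (z : X) : |(1 : ℝ)| ≤ 1 + ‖z‖ := by rw [abs_one]; linarith [norm_nonneg z]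
  have hi := hV.integrable_integral hΨ hm (ne_top_of_le_ne_top ENNReal.coe_ne_top hVC)
    (continuous_const (y := (1 : ℝ))) hone
  -- The constant `1` has linear growth. Weighted by the indicator of `s`, each term of its mean is
  -- the measure of `s`, hence `V y` has total mass one on average over every `s`.
  have key : (fun y => ∫ _, (1 : ℝ) ∂V y) =ᵐ[μ] fun _ => (1 : ℝ) := by
    refine hi.ae_eq_of_forall_setIntegral_eq _ _ (integrable_const _) fun s hs _ => ?_
    have h1 := hS.tendsto_integral_of_isSuperlinear hΨ hm hUC hVC
      (continuous_const (y := (1 : ℝ))) hone (w := s.indicator 1) (B := 1)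
      (aestronglyMeasurable_one.indicator hs) (fun y => by
        by_cases hy : y ∈ s <;> simp [hy])
    have h2 : Tendsto (fun N : ℕ => (N : ℝ)⁻¹ * ∑ n ∈ Finset.range N,
        ∫ y, s.indicator 1 y * (1 : ℝ) ∂μ) atTop (𝓝 (∫ y, s.indicator 1 y * (1 : ℝ) ∂μ)) :=
      Tendsto.cesaro tendsto_const_nhds
    have h3 := tendsto_nhds_unique h1 h2
    have h4 (f : Y → ℝ) : ∫ y, s.indicator 1 y * f y ∂μ = ∫ y in s, f y ∂μ := by
      rw [← integral_indicator hs]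
      congr 1 with y
      by_cases hy : y ∈ s <;> simp [hy]
    exact (h4 _).symm.trans (h3.trans (h4 _))
  filter_upwards [key, hV.ae_isFiniteMeasure] with y hy _
  constructor
  simp only [integral_const, smul_eq_mul, mul_one, measureReal_def] at hy
  rw [← ENNReal.ofReal_toReal (measure_ne_top (V y) Set.univ), hy, ENNReal.ofReal_one]

end growth

/-! ### Test functions -/

/-- A smooth one-periodic function that is equal to the identity on `[ε, 1 - ε]`. -/
theorem exists_smooth_periodic {ε : ℝ} (hε : 0 < ε) :
    ∃ f : ℝ → ℝ, ContDiff ℝ ∞ f ∧ (∀ s, f (s + 1) = f s) ∧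
      ∀ s ∈ Set.Ioo ε (1 - ε), deriv f s = 1 := by
  -- The transitions vanish for `s ≤ ε/2` and `s ≥ 1 - ε/2` respectively and both equal one on `[ε,
  -- 1 - ε]`. Since `θ` is zero near both ends of `[0, 1]`, its composition with `Int.fract` is
  -- smooth across the integers.
  set θ : ℝ → ℝ := fun s => s * (Real.smoothTransition (2 * s / ε - 1)
    * Real.smoothTransition (2 * (1 - s) / ε - 1)) with hθ
  have hθs : ContDiff ℝ ∞ θ := by
    have h1 : ContDiff ℝ ∞ fun s : ℝ => Real.smoothTransition (2 * s / ε - 1) :=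
      Real.smoothTransition.contDiff.comp (by fun_prop)
    have h2 : ContDiff ℝ ∞ fun s : ℝ => Real.smoothTransition (2 * (1 - s) / ε - 1) :=
      Real.smoothTransition.contDiff.comp (by fun_prop)
    exact contDiff_id.mul (h1.mul h2)
  have hθ0 (s : ℝ) (hs : s ≤ ε / 2) : θ s = 0 := by
    have : Real.smoothTransition (2 * s / ε - 1) = 0 := by
      apply Real.smoothTransition.zero_of_nonpos
      rw [sub_nonpos, div_le_one hε]; linarith
    simp [hθ, this]
  have hθ1 (s : ℝ) (hs : 1 - ε / 2 ≤ s) : θ s = 0 := by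
    have : Real.smoothTransition (2 * (1 - s) / ε - 1) = 0 := by
      apply Real.smoothTransition.zero_of_nonpos
      rw [sub_nonpos, div_le_one hε]; linarith
    simp [hθ, this]
  have hθid (s : ℝ) (hs : ε ≤ s) (hs' : s ≤ 1 - ε) : θ s = s := by
    have h1 : Real.smoothTransition (2 * s / ε - 1) = 1 := by
      apply Real.smoothTransition.one_of_one_le
      rw [le_sub_iff_add_le, le_div_iff₀ hε]; linarith
    have h2 : Real.smoothTransition (2 * (1 - s) / ε - 1) = 1 := by
      apply Real.smoothTransition.one_of_one_le
      rw [le_sub_iff_add_le, le_div_iff₀ hε]; linarith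
    simp [hθ, h1, h2]
  refine ⟨fun s => θ (Int.fract s), ?_, fun s => by simp, fun s hs => ?_⟩
  · rw [contDiff_iff_contDiffAt]
    intro s
    by_cases hs : Int.fract s = 0
    · refine (contDiffAt_const (c := (0 : ℝ))).congr_of_eventuallyEq ?_
      obtain ⟨k, rfl⟩ : ∃ k : ℤ, s = k := ⟨⌊s⌋, by
        have := Int.self_sub_floor s; linarith⟩
      -- No upper bound on `ε` is assumed; the minimum with `1` keeps `r` within the two periods
      -- adjacent to `k`.
      have hnear : Set.Ioo ((k : ℝ) - min (ε / 2) 1) (k + min (ε / 2) 1) ∈ 𝓝 (k : ℝ) := by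
        have : 0 < min (ε / 2) 1 := lt_min (by positivity) one_pos
        exact Ioo_mem_nhds (by linarith) (by linarith)
      filter_upwards [hnear] with r hr
      have h1 := min_le_left (ε / 2) 1
      have h2 := min_le_right (ε / 2) 1
      rcases lt_or_ge r k with h | h
      · have : Int.fract r = r - (k - 1) := by
          rw [Int.fract_eq_iff]
          exact ⟨by linarith [hr.1], by linarith, ⟨k - 1, by push_cast; ring⟩⟩
        rw [this]
        exact hθ1 _ (by linarith [hr.1])
      · have : Int.fract r = r - k := by
          rw [Int.fract_eq_iff]
          exact ⟨by linarith, by linarith [hr.2], ⟨k, by ring⟩⟩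
        rw [this]
        exact hθ0 _ (by linarith [hr.2])
    · have hcd : ContDiffAt ℝ ∞ (fun r => θ (r - ⌊s⌋)) s :=
        (hθs.comp (contDiff_id.sub contDiff_const)).contDiffAt
      refine hcd.congr_of_eventuallyEq ?_
      have h1 : (⌊s⌋ : ℝ) < s := lt_of_le_of_ne (Int.floor_le s) fun h => hs (by
        rw [Int.fract, h, sub_self])
      filter_upwards [Ioo_mem_nhds h1 (Int.lt_floor_add_one s)] with r hr
      have : Int.fract r = r - ⌊s⌋ := by
        rw [Int.fract_eq_iff]
        exact ⟨by linarith [hr.1], by linarith [hr.2], ⟨⌊s⌋, by ring⟩⟩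
      rw [this]
  · have : (fun s => θ (Int.fract s)) =ᶠ[𝓝 s] id := by
      filter_upwards [Ioo_mem_nhds hs.1 hs.2] with r hr
      have : Int.fract r = r := Int.fract_eq_self.2 ⟨by linarith [hr.1], by linarith [hr.2]⟩
      rw [this, hθid r hr.1.le hr.2.le, id]
    rw [this.deriv_eq, deriv_id]

/-- A smooth cutoff in time, positive exactly on `(δ, T')`. -/
def timeCutoff (δ T' t : ℝ) : ℝ :=
  Real.smoothTransition (t - δ) * Real.smoothTransition (T' - t)

theorem contDiff_timeCutoff (δ T' : ℝ) : ContDiff ℝ ∞ (timeCutoff δ T') := by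
  have h1 : ContDiff ℝ ∞ fun t : ℝ => Real.smoothTransition (t - δ) :=
    Real.smoothTransition.contDiff.comp (by fun_prop)
  have h2 : ContDiff ℝ ∞ fun t : ℝ => Real.smoothTransition (T' - t) :=
    Real.smoothTransition.contDiff.comp (by fun_prop)
  exact h1.mul h2

theorem timeCutoff_nonneg (δ T' t : ℝ) : 0 ≤ timeCutoff δ T' t :=
  mul_nonneg (Real.smoothTransition.nonneg _) (Real.smoothTransition.nonneg _)

theorem timeCutoff_le_one (δ T' t : ℝ) : timeCutoff δ T' t ≤ 1 :=
  mul_le_one₀ (Real.smoothTransition.le_one _) (Real.smoothTransition.nonneg _)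
    (Real.smoothTransition.le_one _)

theorem timeCutoff_pos {δ T' t : ℝ} (h : t ∈ Set.Ioo δ T') : 0 < timeCutoff δ T' t :=
  mul_pos (Real.smoothTransition.pos_of_pos (sub_pos.2 h.1))
    (Real.smoothTransition.pos_of_pos (sub_pos.2 h.2))

theorem timeCutoff_eq_zero_of_le {δ T' t : ℝ} (h : t ≤ δ) : timeCutoff δ T' t = 0 := by
  rw [timeCutoff, Real.smoothTransition.zero_of_nonpos (sub_nonpos.2 h), zero_mul]

theorem timeCutoff_eq_zero_of_ge {δ T' t : ℝ} (h : T' ≤ t) : timeCutoff δ T' t = 0 := by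
  rw [timeCutoff, Real.smoothTransition.zero_of_nonpos (sub_nonpos.2 h), mul_zero]

/-- A zero of a nonnegative function is a minimum, so the derivative vanishes at the endpoints as
well. -/
theorem deriv_timeCutoff_eq_zero {δ T' t : ℝ} (h : t ∉ Set.Ioo δ T') :
    deriv (timeCutoff δ T') t = 0 := by
  have hmin : IsLocalMin (timeCutoff δ T') t := by
    refine Eventually.of_forall fun s => ?_
    have : timeCutoff δ T' t = 0 := by
      rcases le_or_gt t δ with h1 | h1
      · exact timeCutoff_eq_zero_of_le h1
      · exact timeCutoff_eq_zero_of_ge (not_lt.1 fun h2 => h ⟨h1, h2⟩)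
    rw [this]
    exact timeCutoff_nonneg _ _ _
  exact hmin.deriv_eq_zero

/-! ### Diagonal test fields -/

section testField

variable {d : ℕ}

/-- The vector field `ψ(t) (f(x₁), …, f(x_d))`. -/
def diagField (d : ℕ) (ψ f : ℝ → ℝ) (y : ℝ × Vec d) : Vec d :=
  WithLp.toLp 2 fun i => ψ y.1 * f (y.2 i)

theorem contDiff_diagField {ψ f : ℝ → ℝ} (hψ : ContDiff ℝ ∞ ψ) (hf : ContDiff ℝ ∞ f) :
    ContDiff ℝ ∞ (diagField d ψ f) := by
  rw [contDiff_euclidean]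
  intro i
  have h1 : ContDiff ℝ ∞ fun y : ℝ × Vec d => ψ y.1 := hψ.comp contDiff_fst
  have h2 : ContDiff ℝ ∞ fun y : ℝ × Vec d => f (y.2 i) := hf.comp (by fun_prop)
  exact h1.mul h2

theorem fderiv_diagField_apply {ψ f : ℝ → ℝ} (hψ : ContDiff ℝ ∞ ψ) (hf : ContDiff ℝ ∞ f)
    (y v : ℝ × Vec d) (i : Fin d) :
    fderiv ℝ (diagField d ψ f) y v i
      = v.1 * deriv ψ y.1 * f (y.2 i) + ψ y.1 * (v.2 i * deriv f (y.2 i)) := by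
  have hd : DifferentiableAt ℝ (diagField d ψ f) y :=
    (contDiff_diagField hψ hf).differentiable (by simp) y
  have h1 : HasFDerivAt (fun y : ℝ × Vec d => diagField d ψ f y i)
      ((EuclideanSpace.proj (𝕜 := ℝ) i).comp (fderiv ℝ (diagField d ψ f) y)) y :=
    (EuclideanSpace.proj (𝕜 := ℝ) i).hasFDerivAt.comp y hd.hasFDerivAt
  have hψ' : HasFDerivAt (fun y : ℝ × Vec d => ψ y.1)
      (deriv ψ y.1 • ContinuousLinearMap.fst ℝ ℝ (Vec d)) y :=
    (hψ.differentiable (by simp) y.1).hasDerivAt.comp_hasFDerivAt y hasFDerivAt_fst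
  have hc : HasFDerivAt (fun y : ℝ × Vec d => y.2 i)
      ((EuclideanSpace.proj (𝕜 := ℝ) i).comp (ContinuousLinearMap.snd ℝ ℝ (Vec d))) y :=
    ((EuclideanSpace.proj (𝕜 := ℝ) i).comp (ContinuousLinearMap.snd ℝ ℝ (Vec d))).hasFDerivAt
  have hf' : HasFDerivAt (fun y : ℝ × Vec d => f (y.2 i))
      (deriv f (y.2 i) •
        (EuclideanSpace.proj (𝕜 := ℝ) i).comp (ContinuousLinearMap.snd ℝ ℝ (Vec d))) y :=
    HasDerivAt.comp_hasFDerivAt (f := fun y : ℝ × Vec d => y.2 i) y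
      (hf.differentiable (by simp) (y.2 i)).hasDerivAt hc
  have h2 := h1.unique (hψ'.mul hf')
  have h3 := congrArg (fun L => L v) h2
  refine h3.trans ?_
  simp only [add_apply, smul_apply, ContinuousLinearMap.comp_apply, ContinuousLinearMap.coe_fst',
    ContinuousLinearMap.coe_snd', smul_eq_mul, PiLp.proj_apply]
  ring

theorem dt_diagField {ψ f : ℝ → ℝ} (hψ : ContDiff ℝ ∞ ψ) (hf : ContDiff ℝ ∞ f)
    (y : ℝ × Vec d) (i : Fin d) :
    dt (diagField d ψ f) y i = deriv ψ y.1 * f (y.2 i) := by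
  rw [dt, fderiv_diagField_apply hψ hf]
  simp

theorem dx_diagField {ψ f : ℝ → ℝ} (hψ : ContDiff ℝ ∞ ψ) (hf : ContDiff ℝ ∞ f)
    (y : ℝ × Vec d) (i j : Fin d) :
    dx j (diagField d ψ f) y i = if i = j then ψ y.1 * deriv f (y.2 i) else 0 := by
  rw [dx, fderiv_diagField_apply hψ hf]
  by_cases h : i = j <;> simp [h]

theorem isInteriorTestFunction_diagField {T δ T' : ℝ} (hδ : 0 < δ) (hT' : T' < T) {f : ℝ → ℝ}
    (hf : ContDiff ℝ ∞ f) (hper : ∀ s, f (s + 1) = f s) :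
    IsInteriorTestFunction T (diagField d (timeCutoff δ T') f) where
  smooth := contDiff_diagField (contDiff_timeCutoff δ T') hf
  periodic t x i := by
    ext k
    by_cases h : k = i
    · subst h; simp [diagField, hper]
    · simp [diagField, h]
  vanish := ⟨T', hT', fun t x ht => by
    ext k; simp [diagField, timeCutoff_eq_zero_of_ge ht]⟩
  vanish_left := ⟨δ, hδ, fun t x ht => by
    ext k; simp [diagField, timeCutoff_eq_zero_of_le ht]⟩

/-- The momentum form tested with a diagonal field involves only the diagonal of the stress. -/
theorem momentumForm_diagField (T a γ : ℝ) {ψ f : ℝ → ℝ} (hψ : ContDiff ℝ ∞ ψ)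
    (hf : ContDiff ℝ ∞ f) (ϱ : ℝ × Vec d → ℝ) (m : ℝ × Vec d → Vec d) :
    momentumForm T a γ ϱ m (diagField d ψ f)
      = ∫ y, (∑ i, deriv ψ y.1 * f (y.2 i) * m y i
        + ∑ i, ψ y.1 * deriv f (y.2 i) * (stressPart a γ (some i) (ϱ y, m y)
          + stressPart a γ none (ϱ y, m y))) ∂(spaceTime d T) := by
  rw [momentumForm]
  congr 1 with y
  simp only [dt_diagField hψ hf, dx_diagField hψ hf, mul_ite, mul_zero, Finset.sum_ite_eq,
    Finset.mem_univ, if_true, mul_add, Finset.sum_add_distrib, stressPart, ← add_assoc,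
    Finset.mul_sum]
  congr 1
  · congr 1
    · exact Finset.sum_congr rfl fun i _ => by ring
    · exact Finset.sum_congr rfl fun i _ => by ring
  · exact Finset.sum_congr rfl fun i _ => by ring

/-! ### The cell -/

theorem isOpen_cell : IsOpen (cell d) := by
  have : cell d = ⋂ i, {x : Vec d | x i ∈ Set.Ioo (0 : ℝ) 1} := by
    ext x; simp [cell]
  rw [this]
  refine isOpen_iInter_of_finite fun i => ?_
  exact isOpen_Ioo.preimage (by fun_prop)

theorem isBounded_cell : Bornology.IsBounded (cell d) := by
  refine (Metric.isBounded_closedBall (x := (0 : Vec d)) (r := √d)).subset fun x hx => ?_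
  rw [mem_closedBall_zero_iff, EuclideanSpace.norm_eq]
  refine Real.sqrt_le_sqrt ?_
  calc ∑ i, ‖x i‖ ^ 2 ≤ ∑ _i : Fin d, (1 : ℝ) := Finset.sum_le_sum fun i _ => by
        have := hx i
        rw [Real.norm_of_nonneg this.1.le]
        exact pow_le_one₀ this.1.le this.2.le
    _ = d := by simp

/-- A neighbourhood of the boundary of the cell contains all points near the faces. -/
theorem exists_margin {U : Set (Vec d)} (hU : IsOpen U) (hUbd : frontier (cell d) ⊆ U) :
    ∃ ε > 0, ∀ x ∈ cell d, x ∉ U → ∀ i, x i ∈ Set.Ioo ε (1 - ε) := by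
  have hK : IsCompact (closure (cell d) \ U) :=
    (isBounded_cell.isCompact_closure).diff hU
  have hKc : closure (cell d) \ U ⊆ cell d := by
    rintro x ⟨hx, hxU⟩
    by_contra hxc
    exact hxU (hUbd ⟨hx, by rwa [isOpen_cell.interior_eq]⟩)
  obtain ⟨δ, hδ, hsub⟩ := hK.exists_thickening_subset_open isOpen_cell hKc
  refine ⟨δ / 2, by positivity, fun x hx hxU i => ?_⟩
  -- The part of the closed cell outside `U` has its `δ`-thickening inside the cell. Moving a point
  -- by `δ / 2` along an axis therefore does not leave the cell, which bounds that coordinate away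
  -- from `0` and `1`.
  have key (s : ℝ) (hs : |s| = δ / 2) : x + EuclideanSpace.single i s ∈ cell d := by
    refine hsub (Metric.mem_thickening_iff.2 ⟨x, ⟨subset_closure hx, hxU⟩, ?_⟩)
    rw [dist_eq_norm, add_sub_cancel_left, PiLp.norm_single, Real.norm_eq_abs, hs]
    linarith
  have h1 := (key (-(δ / 2)) (by rw [abs_neg, abs_of_pos (by positivity)]) i).1
  have h2 := (key (δ / 2) (by rw [abs_of_pos (by positivity)]) i).2
  simp only [PiLp.add_apply, PiLp.single_apply, if_true] at h1 h2
  exact ⟨by linarith, by linarith⟩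

end testField

/-! ### Fields of finite energy -/

section finiteEnergy

variable {d : ℕ} {a γ : ℝ} {Y : Type*} [MeasurableSpace Y] {ρ : Measure Y} {f : Y → ℝ × Vec d}

theorem isSuperlinear_energy (ha : 0 < a) (hγ : 1 < γ) :
    IsSuperlinear fun z : ℝ × Vec d => energy a γ z.1 z.2 :=
  fun _ hη => eventually_one_sub_cutoff_mul_le_energy ha hγ hη

theorem ae_mem_admissible (hf : AEMeasurable f ρ)
    (h : ∫⁻ y, energy a γ (f y).1 (f y).2 ∂ρ ≠ ⊤) : ∀ᵐ y ∂ρ, f y ∈ admissible d := by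
  have hm : AEMeasurable (fun y => energy a γ (f y).1 (f y).2) ρ :=
    (measurable_energy (a := a) (γ := γ)).comp_aemeasurable hf
  filter_upwards [ae_lt_top' hm h] with y hy using mem_admissible_of_energy_lt_top hy

theorem integrable_stressPart (ha : 0 < a) (hγ : 1 < γ) (hf : AEMeasurable f ρ)
    (h : ∫⁻ y, energy a γ (f y).1 (f y).2 ∂ρ ≠ ⊤) (k : Option (Fin d)) :
    Integrable (fun y => stressPart a γ k (f y)) ρ := by
  refine ⟨((measurable_stressPart k).comp_aemeasurable hf).aestronglyMeasurable, ?_⟩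
  refine lt_of_le_of_lt (lintegral_mono_ae
    (g := fun y => ENNReal.ofReal (energyCoef γ k)⁻¹ * energy a γ (f y).1 (f y).2) ?_) ?_
  · filter_upwards [ae_mem_admissible hf h] with y hy
    rw [Real.enorm_of_nonneg (stressPart_nonneg ha (nonneg_of_mem_admissible hy) k)]
    exact stressPart_le_energy ha hγ hy k
  · rw [lintegral_const_mul' _ _ ENNReal.ofReal_ne_top]
    exact ENNReal.mul_lt_top ENNReal.ofReal_lt_top h.lt_top

theorem lintegral_energy_eq (ha : 0 < a) (hγ : 1 < γ) (hf : AEMeasurable f ρ)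
    (h : ∫⁻ y, energy a γ (f y).1 (f y).2 ∂ρ ≠ ⊤) :
    ∫⁻ y, energy a γ (f y).1 (f y).2 ∂ρ
      = ENNReal.ofReal (∫ y, ∑ k, energyCoef γ k * stressPart a γ k (f y) ∂ρ) := by
  rw [ofReal_integral_eq_lintegral_ofReal]
  · refine lintegral_congr_ae ?_
    filter_upwards [ae_mem_admissible hf h] with y hy using energy_eq_sum hγ hy
  · exact integrable_finsetSum _ fun k _ => (integrable_stressPart ha hγ hf h k).const_mul _
  · filter_upwards [ae_mem_admissible hf h] with y hy
    exact Finset.sum_nonneg fun k _ => mul_nonneg (energyCoef_pos hγ k).le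
      (stressPart_nonneg ha (nonneg_of_mem_admissible hy) k)

end finiteEnergy

/-! ### Measures of finite energy -/

section finiteEnergyMeasure

variable {d : ℕ} {a γ : ℝ} {ν : Measure (ℝ × Vec d)}

theorem integrable_fst_of_energy [IsFiniteMeasure ν] (ha : 0 < a) (hγ : 1 < γ)
    (h : ∫⁻ z, energy a γ z.1 z.2 ∂ν ≠ ⊤) : Integrable (fun z => z.1) ν :=
  integrable_comp_of_isSuperlinear (f := id) (isSuperlinear_energy ha hγ) aemeasurable_id h
    continuous_fst fun z => (norm_fst_le z).trans (by simp)

theorem integrable_snd_of_energy [IsFiniteMeasure ν] (ha : 0 < a) (hγ : 1 < γ)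
    (h : ∫⁻ z, energy a γ z.1 z.2 ∂ν ≠ ⊤) : Integrable (fun z => z.2) ν := by
  have := integrable_comp_of_isSuperlinear (ρ := ν) (f := id) (isSuperlinear_energy ha hγ)
    aemeasurable_id h (g := fun z => ‖z.2‖) (by fun_prop)
    fun z => by rw [abs_norm]; exact (norm_snd_le z).trans (by simp)
  exact (integrable_norm_iff (by fun_prop)).1 this

/-- The supremum on the right is preferred to `stressPart` because its integral against `V y` is
known to be measurable in `y`. -/
theorem ofReal_integral_stressPart_le [IsFiniteMeasure ν] (ha : 0 < a) (hγ : 1 < γ)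
    (h : ∫⁻ z, energy a γ z.1 z.2 ∂ν ≠ ⊤) (k : Option (Fin d)) :
    ENNReal.ofReal (∫ z, stressPart a γ k z ∂ν)
      ≤ ∫⁻ z, ⨆ j, ENNReal.ofReal (cutoff j z * stressApprox a γ j k z) ∂ν := by
  have hadm := ae_mem_admissible (ρ := ν) (f := id) aemeasurable_id h
  have hi : Integrable (stressPart a γ k) ν :=
    integrable_stressPart (f := id) ha hγ aemeasurable_id h k
  rw [ofReal_integral_eq_lintegral_ofReal hi]
  · refine lintegral_mono_ae ?_
    filter_upwards [hadm] with z hz using ofReal_stressPart_le_iSup hγ hz k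
  · filter_upwards [hadm] with z hz using stressPart_nonneg ha (nonneg_of_mem_admissible hz) k

theorem ofReal_sum_integral_stressPart_le [IsFiniteMeasure ν] (ha : 0 < a) (hγ : 1 < γ)
    (h : ∫⁻ z, energy a γ z.1 z.2 ∂ν ≠ ⊤) {c : Option (Fin d) → ℝ} (hc : ∀ k, 0 ≤ c k) :
    ENNReal.ofReal (∑ k, c k * ∫ z, stressPart a γ k z ∂ν)
      ≤ ∑ k, ENNReal.ofReal (c k)
        * ∫⁻ z, ⨆ j, ENNReal.ofReal (cutoff j z * stressApprox a γ j k z) ∂ν := by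
  have hadm := ae_mem_admissible (ρ := ν) (f := id) aemeasurable_id h
  rw [ENNReal.ofReal_sum_of_nonneg]
  · refine Finset.sum_le_sum fun k _ => ?_
    rw [ENNReal.ofReal_mul (hc k)]
    exact mul_le_mul_right (ofReal_integral_stressPart_le ha hγ h k) _
  · refine fun k _ => mul_nonneg (hc k) (integral_nonneg_of_ae ?_)
    filter_upwards [hadm] with z hz using stressPart_nonneg ha (nonneg_of_mem_admissible hz) k

theorem stressPart_mean_le_of_energy [IsProbabilityMeasure ν] (ha : 0 < a) (hγ : 1 < γ)
    (h : ∫⁻ z, energy a γ z.1 z.2 ∂ν ≠ ⊤) (k : Option (Fin d)) :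
    stressPart a γ k (∫ z, z.1 ∂ν, ∫ z, z.2 ∂ν) ≤ ∫ z, stressPart a γ k z ∂ν :=
  stressPart_mean_le ha hγ (ae_mem_admissible (f := id) aemeasurable_id h)
    (fun k => integrable_stressPart (f := id) ha hγ aemeasurable_id h k)
    (integrable_fst_of_energy ha hγ h) (integrable_snd_of_energy ha hγ h) k

theorem ofReal_sum_stressPart_mean_le [IsProbabilityMeasure ν] (ha : 0 < a) (hγ : 1 < γ)
    (h : ∫⁻ z, energy a γ z.1 z.2 ∂ν ≠ ⊤) {c : Option (Fin d) → ℝ} (hc : ∀ k, 0 ≤ c k) :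
    ENNReal.ofReal (∑ k, c k * stressPart a γ k (∫ z, z.1 ∂ν, ∫ z, z.2 ∂ν))
      ≤ ∑ k, ENNReal.ofReal (c k)
        * ∫⁻ z, ⨆ j, ENNReal.ofReal (cutoff j z * stressApprox a γ j k z) ∂ν :=
  (ENNReal.ofReal_le_ofReal (Finset.sum_le_sum fun k _ =>
    mul_le_mul_of_nonneg_left (stressPart_mean_le_of_energy ha hγ h k) (hc k))).trans
    (ofReal_sum_integral_stressPart_le ha hγ h hc)

theorem mean_mem_admissible_of_energy [IsProbabilityMeasure ν] (ha : 0 < a) (hγ : 1 < γ)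
    (h : ∫⁻ z, energy a γ z.1 z.2 ∂ν ≠ ⊤) :
    (∫ z, z.1 ∂ν, ∫ z, z.2 ∂ν) ∈ admissible d :=
  mean_mem_admissible (ae_mem_admissible (f := id) aemeasurable_id h)
    (integrable_fst_of_energy ha hγ h)

/-- Equality in the weighted Jensen inequality, with positive weights, forces a Dirac mass. -/
theorem eq_dirac_of_sum_le [IsProbabilityMeasure ν] (ha : 0 < a) (hγ : 1 < γ)
    (h : ∫⁻ z, energy a γ z.1 z.2 ∂ν ≠ ⊤) {c : Option (Fin d) → ℝ} (hc : ∀ k, 0 < c k)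
    (hle : ∑ k, ENNReal.ofReal (c k)
        * ∫⁻ z, ⨆ j, ENNReal.ofReal (cutoff j z * stressApprox a γ j k z) ∂ν
      ≤ ENNReal.ofReal (∑ k, c k * stressPart a γ k (∫ z, z.1 ∂ν, ∫ z, z.2 ∂ν))) :
    ν = Measure.dirac (∫ z, z.1 ∂ν, ∫ z, z.2 ∂ν) := by
  have hmean := mean_mem_admissible_of_energy ha hγ h
  have h1 : ∑ k, c k * ∫ z, stressPart a γ k z ∂ν
      ≤ ∑ k, c k * stressPart a γ k (∫ z, z.1 ∂ν, ∫ z, z.2 ∂ν) := by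
    refine (ENNReal.ofReal_le_ofReal_iff (Finset.sum_nonneg fun k _ => mul_nonneg (hc k).le
      (stressPart_nonneg ha (nonneg_of_mem_admissible hmean) k))).1 ?_
    exact (ofReal_sum_integral_stressPart_le ha hγ h fun k => (hc k).le).trans hle
  have h2 (k : Option (Fin d)) (_ : k ∈ Finset.univ) := mul_le_mul_of_nonneg_left
    (stressPart_mean_le_of_energy ha hγ h k) (hc k).le
  -- Jensen holds for each part separately, so equality of the weighted sums gives equality term by
  -- term; positive weights then cancel.
  have h3 := (Finset.sum_eq_sum_iff_of_le h2).1 ((Finset.sum_le_sum h2).antisymm h1)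
  refine eq_dirac_of_stressPart_mean_eq ha hγ (ae_mem_admissible (f := id) aemeasurable_id h)
    (fun k => integrable_stressPart (f := id) ha hγ aemeasurable_id h k)
    (integrable_fst_of_energy ha hγ h) (integrable_snd_of_energy ha hγ h) fun k => ?_
  exact (mul_left_cancel₀ (hc k).ne' (h3 k (Finset.mem_univ k))).symm

end finiteEnergyMeasure

/-! ### (S)-convergent sequences of bounded energy -/

section energyBound

variable {d : ℕ} {a γ : ℝ} {Y : Type*} [MeasurableSpace Y] {μ : Measure Y}
  {Z : ℕ → Y → ℝ × Vec d} {V : Y → Measure (ℝ × Vec d)}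

theorem continuous_cutoff_mul_stressApprox (hγ : 1 < γ) (j : ℕ) (k : Option (Fin d)) :
    Continuous fun z : ℝ × Vec d => cutoff j z * stressApprox a γ j k z :=
  continuous_cutoff_mul j (continuous_stressApprox hγ j k)

theorem IsParametrizedMeasure.aemeasurable_lintegral_energy (hV : IsParametrizedMeasure μ V)
    (ha : 0 < a) (hγ : 1 < γ) : AEMeasurable (fun y => ∫⁻ z, energy a γ z.1 z.2 ∂V y) μ := by
  simp only [energy_eq_iSup ha hγ]
  exact hV.aemeasurable_lintegral_iSup
    (fun j => continuous_cutoff_mul j (continuous_energyApprox hγ j))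
    (fun j => hasCompactSupport_cutoff_mul j _)
    (fun j z => mul_nonneg (cutoff_nonneg j z) (energyApprox_nonneg ha hγ j z))
    (monotone_cutoff_mul_energyApprox ha hγ)

variable [IsFiniteMeasure μ] {C : ℝ≥0}

/-- Lower semicontinuity with the single weight one and the constant `C` as upper bound of the
means. Nothing is presumed about the mass of `V y`; that `V y` is a probability measure is deduced
from this bound. -/
theorem SConvergesTo.lintegral_energy_le (hS : SConvergesTo μ Z V) (ha : 0 < a) (hγ : 1 < γ)
    (hC : ∀ n, ∫⁻ y, energy a γ (Z n y).1 (Z n y).2 ∂μ ≤ C) :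
    ∫⁻ y, ∫⁻ z, energy a γ z.1 z.2 ∂V y ∂μ ≤ C := by
  have hZ := hS.weaklySConvergent.1
  have hm (n) : AEMeasurable (fun y => energy a γ (Z n y).1 (Z n y).2) μ :=
    (measurable_energy (a := a) (γ := γ)).comp_aemeasurable (hZ n)
  have htop (n) : ∫⁻ y, energy a γ (Z n y).1 (Z n y).2 ∂μ ≠ ⊤ :=
    ne_top_of_le_ne_top ENNReal.coe_ne_top (hC n)
  have key := hS.lintegral_iSup_le (ι := Unit) (w := fun _ _ => 1)
    (b := fun _ j z => cutoff j z * energyApprox a γ j z) (fun _ => integrable_const _)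
    (Eventually.of_forall fun _ _ => zero_le_one)
    (fun _ j => continuous_cutoff_mul j (continuous_energyApprox hγ j))
    (fun _ j => hasCompactSupport_cutoff_mul j _)
    (fun _ j z => mul_nonneg (cutoff_nonneg j z) (energyApprox_nonneg ha hγ j z))
    (fun _ => monotone_cutoff_mul_energyApprox ha hγ)
    (F := fun n y => (energy a γ (Z n y).1 (Z n y).2).toReal)
    (fun n => integrable_toReal_of_lintegral_ne_top (hm n) (htop n)) (fun j n => ?_)
    (S := fun _ => (C : ℝ)) tendsto_const_nhds (fun N => ?_)
  · simpa only [Finset.univ_unique, Finset.sum_singleton, ENNReal.ofReal_one, one_mul,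
      ← energy_eq_iSup ha hγ, ENNReal.ofReal_coe_nnreal] using key
  · filter_upwards [ae_lt_top' (hm n) (htop n)] with y hy
    simp only [Finset.univ_unique, Finset.sum_singleton, one_mul]
    exact (ENNReal.ofReal_le_iff_le_toReal hy.ne).1 (ofReal_cutoff_mul_energyApprox_le ha hγ j _)
  · rcases N.eq_zero_or_pos with rfl | hN
    · simp
    rw [inv_mul_le_iff₀ (by exact_mod_cast hN)]
    refine (Finset.sum_le_card_nsmul _ _ (C : ℝ) fun n _ => ?_).trans (by simp)
    rw [integral_toReal (hm n) (ae_lt_top' (hm n) (htop n))]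
    exact ENNReal.toReal_mono ENNReal.coe_ne_top (hC n)

theorem SConvergesTo.ae_lintegral_energy_ne_top (hS : SConvergesTo μ Z V) (ha : 0 < a)
    (hγ : 1 < γ) (hC : ∀ n, ∫⁻ y, energy a γ (Z n y).1 (Z n y).2 ∂μ ≤ C) :
    ∀ᵐ y ∂μ, ∫⁻ z, energy a γ z.1 z.2 ∂V y ≠ ⊤ := by
  filter_upwards [ae_lt_top' (hS.isParametrizedMeasure.aemeasurable_lintegral_energy ha hγ)
    (ne_top_of_le_ne_top ENNReal.coe_ne_top (hS.lintegral_energy_le ha hγ hC))] with y hy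
    using hy.ne

theorem SConvergesTo.ae_isProbabilityMeasure_of_energy (hS : SConvergesTo μ Z V) (ha : 0 < a)
    (hγ : 1 < γ) (hC : ∀ n, ∫⁻ y, energy a γ (Z n y).1 (Z n y).2 ∂μ ≤ C) :
    ∀ᵐ y ∂μ, IsProbabilityMeasure (V y) :=
  hS.ae_isProbabilityMeasure (isSuperlinear_energy ha hγ)
    (hS.isParametrizedMeasure.aemeasurable_lintegral_energy ha hγ) hC
    (hS.lintegral_energy_le ha hγ hC)

/-- If the Cesàro means of a weighted sum of the parts of the stress converge to its value at the
barycenter, then the limit is a Dirac mass wherever the weights are positive. -/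
theorem SConvergesTo.ae_eq_dirac (hS : SConvergesTo μ Z V) (ha : 0 < a) (hγ : 1 < γ)
    (hC : ∀ n, ∫⁻ y, energy a γ (Z n y).1 (Z n y).2 ∂μ ≤ C)
    {w : Option (Fin d) → Y → ℝ} (hwm : ∀ k, AEStronglyMeasurable (w k) μ) {B : ℝ}
    (hwB : ∀ k y, |w k y| ≤ B) (hw0 : ∀ᵐ y ∂μ, ∀ k, 0 ≤ w k y)
    (hint : Integrable (fun y => ∑ k, w k y
      * stressPart a γ k (∫ z, z.1 ∂V y, ∫ z, z.2 ∂V y)) μ)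
    (hlim : Tendsto (fun N : ℕ => (N : ℝ)⁻¹ * ∑ n ∈ Finset.range N,
        ∫ y, ∑ k, w k y * stressPart a γ k (Z n y) ∂μ) atTop
      (𝓝 (∫ y, ∑ k, w k y * stressPart a γ k (∫ z, z.1 ∂V y, ∫ z, z.2 ∂V y) ∂μ))) :
    ∀ᵐ y ∂μ, (∀ k, 0 < w k y) → V y = Measure.dirac (∫ z, z.1 ∂V y, ∫ z, z.2 ∂V y) := by
  have hV := hS.isParametrizedMeasure
  have hZ := hS.weaklySConvergent.1
  have htop (n) : ∫⁻ y, energy a γ (Z n y).1 (Z n y).2 ∂μ ≠ ⊤ :=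
    ne_top_of_le_ne_top ENNReal.coe_ne_top (hC n)
  have hw (k) : Integrable (w k) μ := Integrable.of_bound (hwm k) B
    (Eventually.of_forall fun y => hwB k y)
  have hcont (k : Option (Fin d)) (j : ℕ) := continuous_cutoff_mul_stressApprox (a := a) hγ j k
  have hsupp (k : Option (Fin d)) (j : ℕ) :=
    hasCompactSupport_cutoff_mul j (stressApprox (d := d) a γ j k)
  have hnn (k : Option (Fin d)) (j : ℕ) (z : ℝ × Vec d) :=
    mul_nonneg (cutoff_nonneg j z) (stressApprox_nonneg (γ := γ) ha j k z)
  have hmono (k : Option (Fin d)) := monotone_cutoff_mul_stressApprox (d := d) (γ := γ) ha k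
  -- Lower semicontinuity, with the functional itself as majorant: the integral of the weighted `⟨V;
  -- stress⟩` is at most the limit, which is the value at the barycenter.
  have key := hS.lintegral_iSup_le hw hw0 hcont hsupp hnn hmono
    (F := fun n y => ∑ k, w k y * stressPart a γ k (Z n y))
    (fun n => integrable_finsetSum _ fun k _ =>
      (integrable_stressPart ha hγ (hZ n) (htop n) k).bdd_mul (hwm k)
        (Eventually.of_forall fun y => hwB k y))
    (fun j n => by
      filter_upwards [hw0, ae_mem_admissible (hZ n) (htop n)] with y hy hy'
      refine Finset.sum_le_sum fun k _ => mul_le_mul_of_nonneg_left ?_ (hy k)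
      exact (mul_le_of_le_one_left (stressApprox_nonneg ha _ _ _) (cutoff_le_one _ _)).trans
        (stressApprox_le hγ hy' j k)) hlim (fun N => le_rfl)
  have hprob := hS.ae_isProbabilityMeasure_of_energy ha hγ hC
  have hfin := hS.ae_lintegral_energy_ne_top ha hγ hC
  have hpos : 0 ≤ᵐ[μ] fun y => ∑ k, w k y
      * stressPart a γ k (∫ z, z.1 ∂V y, ∫ z, z.2 ∂V y) := by
    filter_upwards [hw0, hprob, hfin] with y hy _ hy'
    exact Finset.sum_nonneg fun k _ => mul_nonneg (hy k) (stressPart_nonneg ha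
      (nonneg_of_mem_admissible (mean_mem_admissible_of_energy ha hγ hy')) k)
  rw [ofReal_integral_eq_lintegral_ofReal hint hpos] at key
  -- Jensen gives the reverse inequality pointwise. Since the smaller integral is finite, the two
  -- integrands agree almost everywhere.
  have heq := ae_eq_of_ae_le_of_lintegral_le (μ := μ)
    (f := fun y => ENNReal.ofReal (∑ k, w k y
      * stressPart a γ k (∫ z, z.1 ∂V y, ∫ z, z.2 ∂V y))) (by
      filter_upwards [hw0, hprob, hfin] with y hy _ hy'
      exact ofReal_sum_stressPart_mean_le ha hγ hy' hy)
    (by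
      rw [← ofReal_integral_eq_lintegral_ofReal hint hpos]
      exact ENNReal.ofReal_ne_top)
    (Finset.aemeasurable_fun_sum _ fun k _ => (hw k).aemeasurable.ennreal_ofReal.mul
      (hV.aemeasurable_lintegral_iSup (hcont k) (hsupp k) (hnn k) (hmono k))) key
  filter_upwards [heq, hprob, hfin] with y hy _ hy' hwy
  exact eq_dirac_of_sum_le ha hγ hy' hwy hy.ge

end energyBound

/-! ### The space-time domain -/

section spaceTime

variable {d : ℕ} {T : ℝ}

instance isFiniteMeasure_spaceTime : IsFiniteMeasure (spaceTime d T) := by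
  refine ⟨?_⟩
  rw [spaceTime, Measure.restrict_apply_univ]
  exact ((Metric.isBounded_Ioo 0 T).prod isBounded_cell).measure_lt_top

theorem measurableSet_domain : MeasurableSet (Set.Ioo 0 T ×ˢ cell d) :=
  measurableSet_Ioo.prod isOpen_cell.measurableSet

theorem ae_mem_domain : ∀ᵐ y ∂(spaceTime d T), y ∈ Set.Ioo 0 T ×ˢ cell d :=
  ae_restrict_mem measurableSet_domain

theorem spaceTime_restrict_snd {U : Set (Vec d)} (hU : MeasurableSet U) :
    (spaceTime d T).restrict (Prod.snd ⁻¹' U)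
      = (volume.restrict (Set.Ioo 0 T)).prod (volume.restrict (U ∩ cell d)) := by
  rw [spaceTime, Measure.restrict_restrict (measurable_snd hU), Measure.prod_restrict,
    Measure.volume_eq_prod]
  congr 1
  ext y
  simp only [Set.mem_inter_iff, Set.mem_preimage, Set.mem_prod]
  tauto

theorem spaceTime_eq_prod :
    spaceTime d T = (volume.restrict (Set.Ioo 0 T)).prod (volume.restrict (cell d)) := by
  rw [spaceTime, Measure.prod_restrict, Measure.volume_eq_prod]

theorem lintegral_lintegral_eq {U : Set (Vec d)} (hU : MeasurableSet U)
    {F : ℝ × Vec d → ℝ≥0∞} (hF : AEMeasurable F (spaceTime d T)) :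
    ∫⁻ t in Set.Ioo 0 T, ∫⁻ x in U ∩ cell d, F (t, x)
      = ∫⁻ y, F y ∂((spaceTime d T).restrict (Prod.snd ⁻¹' U)) := by
  have := hF.restrict (s := Prod.snd ⁻¹' U)
  rw [spaceTime_restrict_snd hU] at this ⊢
  rw [lintegral_prod _ this]

/-- Multiplication by a bounded function supported in `[δ, T']` makes a locally integrable
function integrable. -/
theorem integrable_mul_of_integrableOn {δ T' : ℝ} {g F : ℝ × Vec d → ℝ}
    (hF : IntegrableOn F (Set.Ioo δ T' ×ˢ cell d) volume) (hg : Measurable g) {B : ℝ}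
    (hB : ∀ y, |g y| ≤ B) (h0 : ∀ y : ℝ × Vec d, y.1 ∉ Set.Ioo δ T' → g y = 0) :
    Integrable (fun y => g y * F y) (spaceTime d T) := by
  have h1 : (fun y => g y * F y) = (Prod.fst ⁻¹' Set.Ioo δ T').indicator fun y => g y * F y := by
    ext y
    by_cases hy : y.1 ∈ Set.Ioo δ T'
    · rw [Set.indicator_of_mem (by exact hy)]
    · rw [Set.indicator_of_notMem (by exact hy), h0 y hy, zero_mul]
  rw [h1, integrable_indicator_iff (measurable_fst measurableSet_Ioo), spaceTime, IntegrableOn,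
    Measure.restrict_restrict (measurable_fst measurableSet_Ioo)]
  have h2 : IntegrableOn (fun y => g y * F y) (Set.Ioo δ T' ×ˢ cell d) volume :=
    Integrable.bdd_mul hF hg.aestronglyMeasurable (Eventually.of_forall hB)
  refine h2.mono_set ?_
  rintro y ⟨hy1, hy2⟩
  exact ⟨hy1, hy2.2⟩

end spaceTime

/-! ### Energy bounds for consistent approximations -/

section approximation

variable {d : ℕ} {T a γ : ℝ} {ϱ : ℕ → ℝ × Vec d → ℝ} {m : ℕ → ℝ × Vec d → Vec d}
  {ϱ₀n : ℕ → Vec d → ℝ} {m₀n : ℕ → Vec d → Vec d} {E : ℕ → ℝ≥0}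
  {ϱ₀ : Vec d → ℝ} {m₀ : Vec d → Vec d}

theorem IsConsistentApproximation.aemeasurable_state
    (h : IsConsistentApproximation T a γ ϱ m ϱ₀n m₀n E ϱ₀ m₀) (n : ℕ) :
    AEMeasurable (fun y => (ϱ n y, m n y)) (spaceTime d T) :=
  (h.measurable_density n).prodMk (h.measurable_momentum n)

theorem IsConsistentApproximation.exists_lintegral_energy_le
    (h : IsConsistentApproximation T a γ ϱ m ϱ₀n m₀n E ϱ₀ m₀) :
    ∃ C : ℝ≥0, ∀ n, ∫⁻ y, energy a γ (ϱ n y) (m n y) ∂(spaceTime d T) ≤ C := by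
  -- The finite limsup bounds `E n` for large `n`; the finitely many remaining values are finite by
  -- type.
  have hbdd : BddAbove (Set.range E) := by
    refine IsBoundedUnder.bddAbove_range ?_
    obtain ⟨K, hK⟩ := ENNReal.lt_iff_exists_nnreal_btwn.1
      (h.limsup_energy.trans_lt h.finite_energy₀)
    refine ⟨K, ?_⟩
    rw [eventually_map]
    filter_upwards [eventually_lt_of_limsup_lt hK.1] with n hn
    exact_mod_cast hn.le
  obtain ⟨K, hK⟩ := hbdd
  refine ⟨K * (T.toNNReal), fun n => ?_⟩
  have hm : AEMeasurable (fun y => energy a γ (ϱ n y) (m n y)) (spaceTime d T) :=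
    (measurable_energy (a := a) (γ := γ)).comp_aemeasurable (h.aemeasurable_state n)
  rw [spaceTime_eq_prod] at hm ⊢
  rw [lintegral_prod _ hm]
  calc _ ≤ ∫⁻ _ in Set.Ioo 0 T, (K : ℝ≥0∞) := by
        refine lintegral_mono_ae ?_
        filter_upwards [h.energy_le n] with t ht
        exact ht.trans (by exact_mod_cast hK ⟨n, rfl⟩)
    _ = _ := by
        rw [lintegral_const, Measure.restrict_apply_univ, Real.volume_Ioo, sub_zero,
          ENNReal.coe_mul]
        rfl

/-- Errors of the momentum equation for interior test functions. -/
theorem IsConsistentApproximation.tendsto_momentumForm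
    (h : IsConsistentApproximation T a γ ϱ m ϱ₀n m₀n E ϱ₀ m₀) {φ : ℝ × Vec d → Vec d}
    (hφ : IsInteriorTestFunction T φ) :
    Tendsto (fun n => momentumForm T a γ (ϱ n) (m n) φ) atTop (𝓝 0) := by
  have h1 := h.momentum φ hφ.toIsTestFunction
  obtain ⟨δ, hδ, h0⟩ := hφ.vanish_left
  have h2 (x : Vec d) : φ (0, x) = 0 := h0 0 x hδ.le
  simpa [h2] using h1

end approximation

/-! ### Weights -/

section weights

variable {d : ℕ}

/-- The coefficients of the parts of the stress in `∑ i, h i * (m_i² / ϱ + p(ϱ))`. -/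
def diagWeight (h : Fin d → ℝ) : Option (Fin d) → ℝ
  | none => ∑ i, h i
  | some i => h i

theorem sum_diagWeight_mul (h : Fin d → ℝ) (P : Option (Fin d) → ℝ) :
    ∑ k, diagWeight h k * P k = ∑ i, h i * (P (some i) + P none) := by
  simp only [Fintype.sum_option, diagWeight, Finset.sum_mul, mul_add, Finset.sum_add_distrib]
  exact add_comm _ _

theorem abs_diagWeight_le (hd : 1 ≤ d) {h : Fin d → ℝ} {M : ℝ} (hM : ∀ i, |h i| ≤ M)
    (k : Option (Fin d)) : |diagWeight h k| ≤ d * M := by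
  have hM0 : 0 ≤ M := (abs_nonneg _).trans (hM ⟨0, hd⟩)
  cases k with
  | none =>
    refine (Finset.abs_sum_le_sum_abs _ _).trans ((Finset.sum_le_sum fun i _ => hM i).trans ?_)
    simp
  | some i =>
    have : (1 : ℝ) ≤ d := by exact_mod_cast hd
    exact (hM i).trans (le_mul_of_one_le_left hM0 this)

/-- Here `1 ≤ d` matters: the weight of the pressure is a sum over the `d` directions, which would
be empty for `d = 0`. -/
theorem diagWeight_pos (hd : 1 ≤ d) {h : Fin d → ℝ} (hh : ∀ i, 0 < h i) (k : Option (Fin d)) :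
    0 < diagWeight h k := by
  cases k with
  | none => exact Finset.sum_pos (fun i _ => hh i) ⟨⟨0, hd⟩, Finset.mem_univ _⟩
  | some i => exact hh i

theorem diagWeight_nonneg {h : Fin d → ℝ} (hh : ∀ i, 0 ≤ h i) (k : Option (Fin d)) :
    0 ≤ diagWeight h k := by
  cases k with
  | none => exact Finset.sum_nonneg fun i _ => hh i
  | some i => exact hh i

theorem measurable_diagWeight {Y : Type*} [MeasurableSpace Y] {h : Fin d → Y → ℝ}
    (hh : ∀ i, Measurable (h i)) (k : Option (Fin d)) :
    Measurable fun y => diagWeight (fun i => h i y) k := by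
  cases k with
  | none => exact Finset.measurable_fun_sum _ fun i _ => hh i
  | some i => exact hh i

theorem exists_lt_mul_energyCoef {γ : ℝ} (hγ : 1 < γ) {M : ℝ} (hM : 0 ≤ M) :
    ∃ lam : ℝ, 0 < lam ∧ ∀ k : Option (Fin d), M < lam * energyCoef γ k := by
  -- The factor `γ + 1` exceeds both `γ - 1` and `2`, the reciprocals of the energy coefficients.
  refine ⟨(M + 1) * (γ + 1), by nlinarith, fun k => ?_⟩
  cases k with
  | none =>
    have : 0 < γ - 1 := sub_pos.2 hγ
    simp only [energyCoef, mul_one_div]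
    rw [lt_div_iff₀ this]
    nlinarith
  | some i =>
    simp only [energyCoef]
    nlinarith

end weights

/-! ### Barycenters -/

section barycenter

variable {d : ℕ} {a γ : ℝ} {Y : Type*} [MeasurableSpace Y] {μ : Measure Y} [IsFiniteMeasure μ]
  {Z : ℕ → Y → ℝ × Vec d} {V : Y → Measure (ℝ × Vec d)} {C : ℝ≥0}

theorem abs_fst_le (z : ℝ × Vec d) : |z.1| ≤ 1 + ‖z‖ := (norm_fst_le z).trans (by simp)

theorem abs_snd_apply_le (i : Fin d) (z : ℝ × Vec d) : |z.2 i| ≤ 1 + ‖z‖ :=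
  ((PiLp.norm_apply_le z.2 i).trans (norm_snd_le z)).trans (by simp)

theorem SConvergesTo.ae_integral_snd_apply (hS : SConvergesTo μ Z V) (ha : 0 < a) (hγ : 1 < γ)
    (hC : ∀ n, ∫⁻ y, energy a γ (Z n y).1 (Z n y).2 ∂μ ≤ C) (i : Fin d) :
    (fun y => ∫ z, z.2 i ∂V y) =ᵐ[μ] fun y => (∫ z, z.2 ∂V y) i := by
  filter_upwards [hS.ae_lintegral_energy_ne_top ha hγ hC,
    hS.isParametrizedMeasure.ae_isFiniteMeasure] with y hy _
  exact (integral_snd_apply (integrable_snd_of_energy ha hγ hy) i).symm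

theorem SConvergesTo.integrable_integral_of_energy (hS : SConvergesTo μ Z V) (ha : 0 < a)
    (hγ : 1 < γ) (hC : ∀ n, ∫⁻ y, energy a γ (Z n y).1 (Z n y).2 ∂μ ≤ C)
    {g : ℝ × Vec d → ℝ} (hgc : Continuous g) (hg : ∀ z, |g z| ≤ 1 + ‖z‖) :
    Integrable (fun y => ∫ z, g z ∂V y) μ :=
  hS.isParametrizedMeasure.integrable_integral (isSuperlinear_energy ha hγ)
    (hS.isParametrizedMeasure.aemeasurable_lintegral_energy ha hγ)
    (ne_top_of_le_ne_top ENNReal.coe_ne_top (hS.lintegral_energy_le ha hγ hC)) hgc hg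

theorem SConvergesTo.integrable_mean_snd_apply (hS : SConvergesTo μ Z V) (ha : 0 < a) (hγ : 1 < γ)
    (hC : ∀ n, ∫⁻ y, energy a γ (Z n y).1 (Z n y).2 ∂μ ≤ C) (i : Fin d) :
    Integrable (fun y => (∫ z, z.2 ∂V y) i) μ :=
  (hS.integrable_integral_of_energy ha hγ hC (g := fun z => z.2 i) (by fun_prop)
    (abs_snd_apply_le i)).congr (hS.ae_integral_snd_apply ha hγ hC i)

theorem SConvergesTo.aemeasurable_mean (hS : SConvergesTo μ Z V) (ha : 0 < a) (hγ : 1 < γ)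
    (hC : ∀ n, ∫⁻ y, energy a γ (Z n y).1 (Z n y).2 ∂μ ≤ C) :
    AEMeasurable (fun y => (∫ z, z.1 ∂V y, ∫ z, z.2 ∂V y)) μ := by
  refine AEMeasurable.prodMk (hS.integrable_integral_of_energy ha hγ hC continuous_fst
    abs_fst_le).aemeasurable ?_
  exact (WithLp.measurable_toLp 2 (Fin d → ℝ)).comp_aemeasurable
    (aemeasurable_pi_lambda (fun y => (∫ z, z.2 ∂V y).ofLp) fun i =>
      (hS.integrable_mean_snd_apply ha hγ hC i).aemeasurable)

end barycenter

/-! ### Convergence of the energy and of the stress -/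

/-- Convergence of the means of the energy in terms of real integrals. -/
theorem tendsto_mean_integral_energy {d : ℕ} {a γ : ℝ} {Y : Type*} [MeasurableSpace Y]
    {ρ : Measure Y} {Z : ℕ → Y → ℝ × Vec d} {Zb : Y → ℝ × Vec d} {C : ℝ≥0} (ha : 0 < a)
    (hγ : 1 < γ) (hZ : ∀ n, AEMeasurable (Z n) ρ) (hZb : AEMeasurable Zb ρ)
    (hC : ∀ n, ∫⁻ y, energy a γ (Z n y).1 (Z n y).2 ∂ρ ≤ C)
    (hE : Tendsto (fun N : ℕ => (N : ℝ≥0∞)⁻¹ * ∑ n ∈ Finset.range N,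
      ∫⁻ y, energy a γ (Z n y).1 (Z n y).2 ∂ρ) atTop
      (𝓝 (∫⁻ y, energy a γ (Zb y).1 (Zb y).2 ∂ρ))) :
    ∫⁻ y, energy a γ (Zb y).1 (Zb y).2 ∂ρ ≠ ⊤ ∧
    Tendsto (fun N : ℕ => (N : ℝ)⁻¹ * ∑ n ∈ Finset.range N,
      ∫ y, ∑ k, energyCoef γ k * stressPart a γ k (Z n y) ∂ρ) atTop
      (𝓝 (∫ y, ∑ k, energyCoef γ k * stressPart a γ k (Zb y) ∂ρ)) := by
  have htop (n) : ∫⁻ y, energy a γ (Z n y).1 (Z n y).2 ∂ρ ≠ ⊤ :=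
    ne_top_of_le_ne_top ENNReal.coe_ne_top (hC n)
  -- A limit of means of numbers at most `C` is at most `C`; finiteness is what allows the passage
  -- from `ENNReal` to real integrals.
  have hlim : ∫⁻ y, energy a γ (Zb y).1 (Zb y).2 ∂ρ ≠ ⊤ := by
    refine ne_top_of_le_ne_top (ENNReal.coe_ne_top (r := C)) (le_of_tendsto' hE fun N => ?_)
    rcases N.eq_zero_or_pos with rfl | hN
    · simp
    refine (mul_le_mul_right ((Finset.sum_le_card_nsmul _ _ (C : ℝ≥0∞) fun n _ => hC n)) _).trans
      ?_
    rw [Finset.card_range, nsmul_eq_mul, ← mul_assoc, ENNReal.inv_mul_cancel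
      (by exact_mod_cast hN.ne') (ENNReal.natCast_ne_top N), one_mul]
  have hreal {f : Y → ℝ × Vec d} (hf : AEMeasurable f ρ)
      (h : ∫⁻ y, energy a γ (f y).1 (f y).2 ∂ρ ≠ ⊤) :
      ∫ y, ∑ k, energyCoef γ k * stressPart a γ k (f y) ∂ρ
        = (∫⁻ y, energy a γ (f y).1 (f y).2 ∂ρ).toReal := by
    rw [lintegral_energy_eq ha hγ hf h, ENNReal.toReal_ofReal]
    refine integral_nonneg_of_ae ?_
    filter_upwards [ae_mem_admissible hf h] with y hy
    exact Finset.sum_nonneg fun k _ => mul_nonneg (energyCoef_pos hγ k).le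
      (stressPart_nonneg ha (nonneg_of_mem_admissible hy) k)
  refine ⟨hlim, ?_⟩
  rw [hreal hZb hlim]
  refine ((ENNReal.tendsto_toReal hlim).comp hE).congr fun N => ?_
  simp only [Function.comp, ENNReal.toReal_mul, ENNReal.toReal_inv, ENNReal.toReal_natCast,
    ENNReal.toReal_sum fun n _ => htop n, fun n => hreal (hZ n) (htop n)]

/-- Splitting of the momentum form for a diagonal test field. -/
theorem momentumForm_diagField_eq_add {d : ℕ} {T a γ : ℝ} {ψ f : ℝ → ℝ} (hψ : ContDiff ℝ ∞ ψ)
    (hf : ContDiff ℝ ∞ f) {ϱ : ℝ × Vec d → ℝ} {m : ℝ × Vec d → Vec d}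
    (hm : ∀ i, Integrable (fun y => deriv ψ y.1 * f (y.2 i) * m y i) (spaceTime d T))
    (hP : Integrable (fun y => ∑ i, ψ y.1 * deriv f (y.2 i) * (stressPart a γ (some i) (ϱ y, m y)
      + stressPart a γ none (ϱ y, m y))) (spaceTime d T)) :
    momentumForm T a γ ϱ m (diagField d ψ f)
      = ∑ i, ∫ y, deriv ψ y.1 * f (y.2 i) * m y i ∂(spaceTime d T)
        + ∫ y, ∑ i, ψ y.1 * deriv f (y.2 i) * (stressPart a γ (some i) (ϱ y, m y)
          + stressPart a γ none (ϱ y, m y)) ∂(spaceTime d T) := by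
  rw [momentumForm_diagField T a γ hψ hf, integral_add (integrable_finsetSum _ fun i _ => hm i) hP,
    integral_finsetSum _ fun i _ => hm i]

theorem exists_bound_of_periodic {f : ℝ → ℝ} (hf : Continuous f) (hper : ∀ s, f (s + 1) = f s) :
    ∃ M, ∀ s, |f s| ≤ M := by
  obtain ⟨M, hM⟩ := (Function.Periodic.isBounded_of_continuous hper one_ne_zero
    hf).exists_norm_le
  exact ⟨M, fun s => hM _ ⟨s, rfl⟩⟩

theorem deriv_periodic {f : ℝ → ℝ} (hper : ∀ s, f (s + 1) = f s) (s : ℝ) :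
    deriv f (s + 1) = deriv f s := by
  have : (fun s => f (s + 1)) = f := funext hper
  rw [← deriv_comp_add_const, this]

theorem exists_bound_deriv_timeCutoff (δ T' : ℝ) :
    ∃ M, ∀ t, |deriv (timeCutoff δ T') t| ≤ M := by
  have hs : HasCompactSupport (deriv (timeCutoff δ T')) :=
    HasCompactSupport.of_support_subset_isCompact (isCompact_Icc (a := δ) (b := T')) fun t ht => by
      by_contra h
      exact ht (deriv_timeCutoff_eq_zero fun h' => h (Set.Ioo_subset_Icc_self h'))
  exact hs.exists_bound_of_continuous ((contDiff_timeCutoff δ T').continuous_deriv (by simp))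

/-! ### The tested momentum equation and the Dirac property -/

section main

variable {d : ℕ} {T a γ : ℝ} {ϱ : ℕ → ℝ × Vec d → ℝ} {m : ℕ → ℝ × Vec d → Vec d}
  {ϱ₀n : ℕ → Vec d → ℝ} {m₀n : ℕ → Vec d → Vec d} {E : ℕ → ℝ≥0}
  {ϱ₀ : Vec d → ℝ} {m₀ : Vec d → Vec d} {V : ℝ × Vec d → Measure (ℝ × Vec d)} {δ T' : ℝ}
  {f : ℝ → ℝ}

theorem measurable_timeCutoff_mul_deriv (δ T' : ℝ) (f : ℝ → ℝ) (i : Fin d) :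
    Measurable fun y : ℝ × Vec d => timeCutoff δ T' y.1 * deriv f (y.2 i) := by
  have h1 : Measurable fun y : ℝ × Vec d => timeCutoff δ T' y.1 :=
    (contDiff_timeCutoff δ T').continuous.measurable.comp measurable_fst
  have h2 : Measurable fun y : ℝ × Vec d => deriv f (y.2 i) :=
    (measurable_deriv f).comp (by fun_prop)
  exact h1.mul h2

theorem abs_timeCutoff_mul_deriv_le {M : ℝ} (hM : ∀ s, |deriv f s| ≤ M) (i : Fin d)
    (y : ℝ × Vec d) : |timeCutoff δ T' y.1 * deriv f (y.2 i)| ≤ M := by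
  rw [abs_mul, abs_of_nonneg (timeCutoff_nonneg _ _ _)]
  exact (mul_le_of_le_one_left (abs_nonneg _) (timeCutoff_le_one _ _ _)).trans (hM _)

/-- The stress of a weak solution against a diagonal field is integrable. -/
theorem IsWeakSolution.integrable_diag {ϱ : ℝ × Vec d → ℝ} {m : ℝ × Vec d → Vec d}
    (h : IsWeakSolution T a γ ϱ m) (hδ : 0 < δ) (hT' : T' < T) {M : ℝ}
    (hM : ∀ s, |deriv f s| ≤ M) :
    Integrable (fun y => ∑ i, timeCutoff δ T' y.1 * deriv f (y.2 i)
      * (stressPart a γ (some i) (ϱ y, m y) + stressPart a γ none (ϱ y, m y)))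
      (spaceTime d T) := by
  refine integrable_finsetSum _ fun i _ => integrable_mul_of_integrableOn (δ := δ) (T' := T')
    ((h.integrable_convFlux δ T' hδ hT' i i).add (h.integrable_pressure δ T' hδ hT'))
    (measurable_timeCutoff_mul_deriv δ T' f i) (abs_timeCutoff_mul_deriv_le hM i) fun y hy => ?_
  have : timeCutoff δ T' y.1 = 0 := by
    rcases le_or_gt y.1 δ with h1 | h1
    · exact timeCutoff_eq_zero_of_le h1
    · exact timeCutoff_eq_zero_of_ge (not_lt.1 fun h2 => hy ⟨h1, h2⟩)
  rw [this, zero_mul]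

/-- Convergence of the means of the diagonal stress against `ψ(t) f'(x_i)`. -/
theorem tendsto_mean_integral_diag (ha : 0 < a) (hγ : 1 < γ)
    (hcons : IsConsistentApproximation T a γ ϱ m ϱ₀n m₀n E ϱ₀ m₀)
    (hS : SConvergesTo (spaceTime d T) (fun n y => (ϱ n y, m n y)) V)
    (hweak : IsWeakSolution T a γ (meanDensity V) (meanMomentum V))
    (hδ : 0 < δ) (hT' : T' < T) (hf : ContDiff ℝ ∞ f) (hper : ∀ s, f (s + 1) = f s) :
    Tendsto (fun N : ℕ => (N : ℝ)⁻¹ * ∑ n ∈ Finset.range N,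
      ∫ y, ∑ i, timeCutoff δ T' y.1 * deriv f (y.2 i) * (stressPart a γ (some i) (ϱ n y, m n y)
          + stressPart a γ none (ϱ n y, m n y)) ∂(spaceTime d T)) atTop
      (𝓝 (∫ y, ∑ i, timeCutoff δ T' y.1 * deriv f (y.2 i)
        * (stressPart a γ (some i) (meanDensity V y, meanMomentum V y)
          + stressPart a γ none (meanDensity V y, meanMomentum V y)) ∂(spaceTime d T))) := by
  obtain ⟨C, hC⟩ := hcons.exists_lintegral_energy_le
  have htop (n) := ne_top_of_le_ne_top ENNReal.coe_ne_top (hC n)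
  have hZ := hcons.aemeasurable_state
  have hψ := contDiff_timeCutoff δ T'
  obtain ⟨Mf, hMf⟩ := exists_bound_of_periodic hf.continuous hper
  obtain ⟨M, hM⟩ := exists_bound_of_periodic (hf.continuous_deriv (by simp)) (deriv_periodic hper)
  obtain ⟨Mψ, hMψ⟩ := exists_bound_deriv_timeCutoff δ T'
  set w : Fin d → ℝ × Vec d → ℝ := fun i y => deriv (timeCutoff δ T') y.1 * f (y.2 i) with hw
  have hwm (i : Fin d) : AEStronglyMeasurable (w i) (spaceTime d T) := by
    have h1 : Measurable fun y : ℝ × Vec d => deriv (timeCutoff δ T') y.1 :=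
      (measurable_deriv _).comp measurable_fst
    have h2 : Measurable fun y : ℝ × Vec d => f (y.2 i) :=
      hf.continuous.measurable.comp (by fun_prop)
    exact (h1.mul h2).aestronglyMeasurable
  have hwB (i : Fin d) (y : ℝ × Vec d) : |w i y| ≤ Mψ * Mf := by
    rw [hw, abs_mul]
    exact mul_le_mul (hMψ _) (hMf _) (abs_nonneg _) ((abs_nonneg _).trans (hMψ 0))
  have hmint (n : ℕ) (i : Fin d) : Integrable (fun y => w i y * m n y i) (spaceTime d T) :=
    (integrable_comp_of_isSuperlinear (isSuperlinear_energy ha hγ) (hZ n) (htop n)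
      (g := fun z => z.2 i) (by fun_prop) (abs_snd_apply_le i)).bdd_mul (hwm i)
      (Eventually.of_forall (hwB i))
  have hPint (n : ℕ) : Integrable (fun y => ∑ i, timeCutoff δ T' y.1 * deriv f (y.2 i)
      * (stressPart a γ (some i) (ϱ n y, m n y) + stressPart a γ none (ϱ n y, m n y)))
      (spaceTime d T) :=
    integrable_finsetSum _ fun i _ => Integrable.bdd_mul
      ((integrable_stressPart ha hγ (hZ n) (htop n) (some i)).add
        (integrable_stressPart ha hγ (hZ n) (htop n) none))
      (measurable_timeCutoff_mul_deriv δ T' f i).aestronglyMeasurable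
      (Eventually.of_forall (abs_timeCutoff_mul_deriv_le hM i))
  have hmintV (i : Fin d) : Integrable (fun y => w i y * meanMomentum V y i) (spaceTime d T) :=
    (hS.integrable_mean_snd_apply ha hγ hC i).bdd_mul (hwm i) (Eventually.of_forall (hwB i))
  have htest := isInteriorTestFunction_diagField (d := d) hδ hT' hf hper
  have h1 := (hcons.tendsto_momentumForm htest).cesaro
  have h2 : Tendsto (fun N : ℕ => ∑ i, (N : ℝ)⁻¹ * ∑ n ∈ Finset.range N,
      ∫ y, w i y * m n y i ∂(spaceTime d T)) atTop
      (𝓝 (∑ i, ∫ y, w i y * meanMomentum V y i ∂(spaceTime d T))) := by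
    refine tendsto_finsetSum _ fun i _ => ?_
    have h := hS.tendsto_integral_of_isSuperlinear (isSuperlinear_energy ha hγ)
      (hS.isParametrizedMeasure.aemeasurable_lintegral_energy ha hγ) hC
      (hS.lintegral_energy_le ha hγ hC) (g := fun z => z.2 i) (by fun_prop)
      (abs_snd_apply_le i) (hwm i) (hwB i)
    have heq : ∫ y, w i y * ∫ z, z.2 i ∂V y ∂(spaceTime d T)
        = ∫ y, w i y * meanMomentum V y i ∂(spaceTime d T) := by
      refine integral_congr_ae ?_
      filter_upwards [hS.ae_integral_snd_apply ha hγ hC i] with y hy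
      rw [hy, meanMomentum]
    rwa [heq] at h
  have h3 := hweak.momentum _ htest
  rw [momentumForm_diagField_eq_add hψ hf hmintV (hweak.integrable_diag hδ hT' hM)] at h3
  -- By `h3` the barycenter's time term and stress term add up to zero, so minus the limit of the
  -- time terms is the stress of the barycenter.
  have h4 := h1.sub h2
  rw [zero_sub, neg_eq_of_add_eq_zero_right h3] at h4
  refine h4.congr fun N => ?_
  simp only [fun n => momentumForm_diagField_eq_add (a := a) (γ := γ) hψ hf (hmint n) (hPint n),
    Finset.sum_add_distrib, mul_add]
  rw [Finset.sum_comm, Finset.mul_sum, add_sub_cancel_left]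

/-- A multiple `lam` of the energy over `U` plus the tested stress over the whole cell is a weighted
sum of the parts of the stress. Both summands converge in the mean to their values at the
barycenter, and all weights are positive at times in `(δ, T')`. -/
theorem ae_eq_dirac_of_mem_Ioo (hd : 1 ≤ d) (ha : 0 < a) (hγ : 1 < γ)
    (hcons : IsConsistentApproximation T a γ ϱ m ϱ₀n m₀n E ϱ₀ m₀)
    (hS : SConvergesTo (spaceTime d T) (fun n y => (ϱ n y, m n y)) V)
    {U : Set (Vec d)} (hU : IsOpen U) (hUbd : frontier (cell d) ⊆ U)
    (hE : Tendsto (fun N : ℕ => (N : ℝ≥0∞)⁻¹ * ∑ n ∈ Finset.range N,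
        ∫⁻ t in Set.Ioo 0 T, ∫⁻ x in U ∩ cell d, energy a γ (ϱ n (t, x)) (m n (t, x))) atTop
      (𝓝 (∫⁻ t in Set.Ioo 0 T, ∫⁻ x in U ∩ cell d,
        energy a γ (meanDensity V (t, x)) (meanMomentum V (t, x)))))
    (hweak : IsWeakSolution T a γ (meanDensity V) (meanMomentum V))
    (hδ : 0 < δ) (hT' : T' < T) :
    ∀ᵐ y ∂(spaceTime d T), y.1 ∈ Set.Ioo δ T' →
      V y = Measure.dirac (meanDensity V y, meanMomentum V y) := by
  obtain ⟨C, hC⟩ := hcons.exists_lintegral_energy_le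
  have htop (n) := ne_top_of_le_ne_top ENNReal.coe_ne_top (hC n)
  have hZ := hcons.aemeasurable_state
  have hZb : AEMeasurable (fun y => (meanDensity V y, meanMomentum V y)) (spaceTime d T) :=
    hS.aemeasurable_mean ha hγ hC
  obtain ⟨ε, hε, hmargin⟩ := exists_margin hU hUbd
  obtain ⟨f, hf, hper, hf1⟩ := exists_smooth_periodic hε
  obtain ⟨M, hM⟩ := exists_bound_of_periodic (hf.continuous_deriv (by simp)) (deriv_periodic hper)
  have hM0 : 0 ≤ M := (abs_nonneg _).trans (hM 0)
  obtain ⟨lam, hlam, hlamM⟩ := exists_lt_mul_energyCoef (d := d) hγ (M := d * M) (by positivity)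
  have hUm : MeasurableSet (Prod.snd ⁻¹' U : Set (ℝ × Vec d)) := measurable_snd hU.measurableSet
  -- convergence of the energy near the boundary
  have hme {r : ℝ × Vec d → ℝ × Vec d} (hr : AEMeasurable r (spaceTime d T)) :
      ∫⁻ t in Set.Ioo 0 T, ∫⁻ x in U ∩ cell d, energy a γ (r (t, x)).1 (r (t, x)).2
        = ∫⁻ y, energy a γ (r y).1 (r y).2 ∂((spaceTime d T).restrict (Prod.snd ⁻¹' U)) :=
    lintegral_lintegral_eq (F := fun y => energy a γ (r y).1 (r y).2) hU.measurableSet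
      ((measurable_energy (a := a) (γ := γ)).comp_aemeasurable hr)
  have hE' : Tendsto (fun N : ℕ => (N : ℝ≥0∞)⁻¹ * ∑ n ∈ Finset.range N,
      ∫⁻ y, energy a γ (ϱ n y) (m n y) ∂((spaceTime d T).restrict (Prod.snd ⁻¹' U))) atTop
      (𝓝 (∫⁻ y, energy a γ (meanDensity V y) (meanMomentum V y)
        ∂((spaceTime d T).restrict (Prod.snd ⁻¹' U)))) := by
    rw [← hme hZb]
    simpa only [fun n => hme (hZ n)] using hE
  obtain ⟨hEfin, hElim⟩ := tendsto_mean_integral_energy (Zb := fun y =>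
    (meanDensity V y, meanMomentum V y)) ha hγ (fun n => (hZ n).restrict) hZb.restrict
    (fun n => (lintegral_mono' Measure.restrict_le_self le_rfl).trans (hC n)) hE'
  have hPlim := tendsto_mean_integral_diag ha hγ hcons hS hweak hδ hT' hf hper
  -- the weights
  set H : Fin d → ℝ × Vec d → ℝ := fun i y => timeCutoff δ T' y.1 * deriv f (y.2 i) with hH
  have hHm (i) : Measurable (H i) := measurable_timeCutoff_mul_deriv δ T' f i
  have hHB (i y) : |H i y| ≤ M := abs_timeCutoff_mul_deriv_le hM i y
  -- Over `U` the second term may be negative but is at most `d * M` in absolute value, and `lam`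
  -- was chosen so that the first term is larger for every part.
  set w : Option (Fin d) → ℝ × Vec d → ℝ := fun k y =>
    (Prod.snd ⁻¹' U).indicator (fun _ => lam * energyCoef γ k) y
      + diagWeight (fun i => H i y) k with hw
  have hcoef (k : Option (Fin d)) := energyCoef_pos hγ k
  have hsplit (z : ℝ × Vec d) (y : ℝ × Vec d) : ∑ k, w k y * stressPart a γ k z
      = lam * (Prod.snd ⁻¹' U).indicator
          (fun _ => ∑ k, energyCoef γ k * stressPart a γ k z) y
        + ∑ i, H i y * (stressPart a γ (some i) z + stressPart a γ none z) := by
    simp only [hw, add_mul, Finset.sum_add_distrib,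
      sum_diagWeight_mul (fun i => H i y) fun k => stressPart a γ k z]
    congr 1
    by_cases hy : y ∈ (Prod.snd ⁻¹' U : Set (ℝ × Vec d))
    · simp only [Set.indicator_of_mem hy, Finset.mul_sum, mul_assoc]
    · simp [Set.indicator_of_notMem hy]
  have hintegral {r : ℝ × Vec d → ℝ × Vec d}
      (h1 : Integrable (fun y => ∑ k, energyCoef γ k * stressPart a γ k (r y))
        ((spaceTime d T).restrict (Prod.snd ⁻¹' U)))
      (h2 : Integrable (fun y => ∑ i, H i y * (stressPart a γ (some i) (r y)
        + stressPart a γ none (r y))) (spaceTime d T)) :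
      Integrable (fun y => ∑ k, w k y * stressPart a γ k (r y)) (spaceTime d T) ∧
      ∫ y, ∑ k, w k y * stressPart a γ k (r y) ∂(spaceTime d T)
        = lam * ∫ y, ∑ k, energyCoef γ k * stressPart a γ k (r y)
            ∂((spaceTime d T).restrict (Prod.snd ⁻¹' U))
          + ∫ y, ∑ i, H i y * (stressPart a γ (some i) (r y) + stressPart a γ none (r y))
            ∂(spaceTime d T) := by
    have h3 : Integrable (fun y => lam * (Prod.snd ⁻¹' U).indicator
        (fun y => ∑ k, energyCoef γ k * stressPart a γ k (r y)) y) (spaceTime d T) :=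
      ((integrable_indicator_iff hUm).2 h1).const_mul lam
    have h4 : (fun y => ∑ k, w k y * stressPart a γ k (r y)) = fun y =>
        lam * (Prod.snd ⁻¹' U).indicator
          (fun y => ∑ k, energyCoef γ k * stressPart a γ k (r y)) y
        + ∑ i, H i y * (stressPart a γ (some i) (r y) + stressPart a γ none (r y)) := by
      funext y
      rw [hsplit]
      by_cases hy : y ∈ (Prod.snd ⁻¹' U : Set (ℝ × Vec d))
      · simp only [Set.indicator_of_mem hy]
      · simp only [Set.indicator_of_notMem hy]
    rw [h4]
    refine ⟨h3.add h2, ?_⟩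
    rw [integral_add h3 h2, integral_const_mul, integral_indicator hUm]
  have hintn (n : ℕ) := (hintegral (r := fun y => (ϱ n y, m n y))
    (integrable_finsetSum _ fun k _ =>
      ((integrable_stressPart ha hγ (hZ n) (htop n) k).const_mul _).restrict)
    (integrable_finsetSum _ fun i _ => Integrable.bdd_mul
      ((integrable_stressPart ha hγ (hZ n) (htop n) (some i)).add
        (integrable_stressPart ha hγ (hZ n) (htop n) none)) (hHm i).aestronglyMeasurable
      (Eventually.of_forall (hHB i)))).2
  -- For the barycenter, integrability comes from two sources: the finite energy over `U` obtained
  -- as a limit, and the local integrability contained in the notion of weak solution.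
  have hintb := hintegral (r := fun y => (meanDensity V y, meanMomentum V y))
    (integrable_finsetSum _ fun k _ =>
      (integrable_stressPart ha hγ hZb.restrict hEfin k).const_mul _)
    (hweak.integrable_diag hδ hT' hM)
  have hdW (y : ℝ × Vec d) (k : Option (Fin d)) := abs_diagWeight_le hd (fun i => hHB i y) k
  have hwU {y : ℝ × Vec d} (hy : y ∈ (Prod.snd ⁻¹' U : Set (ℝ × Vec d))) (k) : 0 < w k y := by
    simp only [hw, Set.indicator_of_mem hy]
    linarith [hlamM k, neg_abs_le (diagWeight (fun i => H i y) k), hdW y k]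
  -- Outside `U` every coordinate lies in `(ε, 1 - ε)`, where `f' = 1`: the test gradient is `ψ(t)`
  -- times the identity.
  have hwUc {y : ℝ × Vec d} (hyc : y.2 ∈ cell d)
      (hy : y ∉ (Prod.snd ⁻¹' U : Set (ℝ × Vec d))) (k) :
      w k y = diagWeight (fun _ : Fin d => timeCutoff δ T' y.1) k := by
    simp only [hw, hH, Set.indicator_of_notMem hy, zero_add,
      fun i => hf1 _ (hmargin y.2 hyc hy i), mul_one]
  have key := hS.ae_eq_dirac ha hγ hC (w := w) (B := lam * ∑ k, energyCoef γ k + d * M)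
    (fun k => ((measurable_const.indicator hUm).add
      (measurable_diagWeight hHm k)).aestronglyMeasurable)
    (fun k y => by
      refine (abs_add_le _ _).trans (add_le_add ?_ (hdW y k))
      have h1 : energyCoef γ k ≤ ∑ k, energyCoef γ k :=
        Finset.single_le_sum (fun k _ => (hcoef k).le) (Finset.mem_univ k)
      have h2 : 0 < lam * energyCoef γ k := mul_pos hlam (hcoef k)
      refine le_trans ?_ (mul_le_mul_of_nonneg_left h1 hlam.le)
      by_cases hy : y ∈ (Prod.snd ⁻¹' U : Set (ℝ × Vec d))
      · rw [Set.indicator_of_mem hy, abs_of_pos h2]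
      · rw [Set.indicator_of_notMem hy, abs_zero]; exact h2.le)
    (by
      filter_upwards [ae_mem_domain] with y hy k
      by_cases hyU : y ∈ (Prod.snd ⁻¹' U : Set (ℝ × Vec d))
      · exact (hwU hyU k).le
      · rw [hwUc hy.2 hyU]
        exact diagWeight_nonneg (fun _ => timeCutoff_nonneg _ _ _) k)
    hintb.1 (by
      refine ((hElim.const_mul lam).add hPlim).congr (fun N => ?_) |>.trans_eq
        (congrArg 𝓝 hintb.2.symm)
      simp only [hintn, Finset.sum_add_distrib, ← Finset.mul_sum, mul_add]
      rw [mul_left_comm])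
  filter_upwards [key, ae_mem_domain] with y hy hyd hyt
  refine hy fun k => ?_
  by_cases hyU : y ∈ (Prod.snd ⁻¹' U : Set (ℝ × Vec d))
  · exact hwU hyU k
  · rw [hwUc hyd.2 hyU]
    exact diagWeight_pos hd (fun _ => timeCutoff_pos hyt) k

end main

end

end IsentropicEuler

theorem theorem5p1 (d : ℕ) (hd : 1 ≤ d) (T a γ : ℝ) (hT : 0 < T) (ha : 0 < a) (hγ : 1 < γ)
    (ϱ : ℕ → ℝ × IsentropicEuler.Vec d → ℝ)
    (m : ℕ → ℝ × IsentropicEuler.Vec d → IsentropicEuler.Vec d)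
    (ϱ₀n : ℕ → IsentropicEuler.Vec d → ℝ)
    (m₀n : ℕ → IsentropicEuler.Vec d → IsentropicEuler.Vec d)
    (E : ℕ → NNReal)
    (ϱ₀ : IsentropicEuler.Vec d → ℝ) (m₀ : IsentropicEuler.Vec d → IsentropicEuler.Vec d)
    (hcons : IsentropicEuler.IsConsistentApproximation T a γ ϱ m ϱ₀n m₀n E ϱ₀ m₀)
    (V : ℝ × IsentropicEuler.Vec d → MeasureTheory.Measure (ℝ × IsentropicEuler.Vec d))
    (hS : IsentropicEuler.SConvergesTo (IsentropicEuler.spaceTime d T)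
      (fun n y => (ϱ n y, m n y)) V)
    (U : Set (IsentropicEuler.Vec d)) (hU : IsOpen U)
    (hUbd : frontier (IsentropicEuler.cell d) ⊆ U)
    (hE : Filter.Tendsto
      (fun N : ℕ => (N : ENNReal)⁻¹ * ∑ n ∈ Finset.range N,
        ∫⁻ t in Set.Ioo 0 T, ∫⁻ x in U ∩ IsentropicEuler.cell d,
          IsentropicEuler.energy a γ (ϱ n (t, x)) (m n (t, x)))
      Filter.atTop
      (nhds (∫⁻ t in Set.Ioo 0 T, ∫⁻ x in U ∩ IsentropicEuler.cell d,
        IsentropicEuler.energy a γ (IsentropicEuler.meanDensity V (t, x))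
          (IsentropicEuler.meanMomentum V (t, x)))))
    (hweak : IsentropicEuler.IsWeakSolution T a γ
      (IsentropicEuler.meanDensity V) (IsentropicEuler.meanMomentum V)) :
    ∀ᵐ y ∂(IsentropicEuler.spaceTime d T),
      V y = MeasureTheory.Measure.dirac
        (IsentropicEuler.meanDensity V y, IsentropicEuler.meanMomentum V y) := by
  -- Interior test functions vanish near the times `0` and `T`, so `(0, T)` is exhausted by
  -- countably many intervals and their null sets are collected. For small `n` the interval may be
  -- empty, which is harmless.
  have h (n : ℕ) := IsentropicEuler.ae_eq_dirac_of_mem_Ioo hd ha hγ hcons hS hU hUbd hE hweak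
    (δ := 1 / ((n : ℝ) + 1)) (T' := T - 1 / ((n : ℝ) + 1)) (by positivity)
    (sub_lt_self T (by positivity))
  filter_upwards [MeasureTheory.ae_all_iff.2 h, IsentropicEuler.ae_mem_domain] with y hy hyd
  obtain ⟨n, hn⟩ := exists_nat_one_div_lt (lt_min hyd.1.1 (sub_pos.2 hyd.1.2))
  exact hy n ⟨hn.trans_le (min_le_left _ _), by linarith [hn.trans_le (min_le_right _ _)]⟩
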